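/- Let $\xi$ be a random variable with law $\mu$, let $f(\cdot;\xi):\mathbb R^n\to\mathbb R$ be such that $f(x;\cdot)$ is integrable for every $x$, and put $F(x)=\mathbb E_\xi[f(x;\xi)]$. Let $r:\mathbb R^n\to\mathbb R\cup\{+\infty\}$ be closed and convex, $\phi=F+r$, and $\phi^*=\inf\phi>-\infty$. For a function $h$, $\partial h(x)$ denotes the set of all $v$ with $h(y)\ge h(x)+\langle v,y-x\rangle+o(\|y-x\|)$ as $y\to x$; for $c>0$, $\mathrm{prox}_{cr}(z)=\arg\min_y\{r(y)+\frac1{2c}\|y-z\|^2\}$; and for $\lambda>0$, $\phi_\lambda(x)=\inf_y\{\phi(y)+\frac1{2\lambda}\|y-x\|^2\}$ is the Moreau envelope of $\phi$. Assumptions. (1) $F$ is $\rho$-weakly convex with $\rho>0$, i.e. $F+\frac\rho2\|\cdot\|^2$ is convex. (2) For each $k$, $\tilde\nabla_k f(x;\xi)$ is a jointly measurable choice of sample subgradients, $\tilde\nabla_k f(x;\xi)\in\partial f(x;\xi)$ for all $x\in\mathrm{dom}(r)$ and almost every $\xi$, which is unbiased: $\mathbb E_\xi[\tilde\nabla_k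 f(x;\xi)]\in\partial F(x)$ for all $x\in\mathrm{dom}(r)$. (3) There is $M\ge0$ such that $\mathbb E_\xi\|s(\xi)\|^2\le M^2$ for all $x\in\mathrm{dom}(r)$ and all measurable $s$ with $s(\xi)\in\partial f(x;\xi)$ for almost every $\xi$. (4) There are an integer $\tau\ge0$ and probabilities $p_0,\dots,p_\tau$ summing to $1$ with $\mathrm{Prob}(\tau_k=j)=p_j$ for all $k$ and all $j=0,\dots,\tau$. The samples $\xi_k$ have law $\mu$, and all the $\xi_k$ and $\tau_k$ are mutually independent. (5) $F(x)\le C_F$ for all $x\in\mathrm{dom}(r)$. Let $K\ge1$, $\bar\rho\in(\rho,2\rho]$, $\alpha>0$ and $\beta\ge0$ with $\frac{\alpha}{\sqrt K}\le\frac1{\bar\rho}$ and $\frac{\beta}{K^{1/4}}<1-\frac{\alpha\rho}{2\sqrt K}$, and set $\alpha_k=\frac{\alpha}{\sqrt K}$, $\beta_k=\frac{\beta}{K^{1/4}}$ for $k=1,\dots,K$. Let $x^{(1)}=x^{(0)}\in\mathrm{dom}(r)$ be deterministic and, for $k=1,\dots,K$, $$x^{(k+1)}=\mathrm{prox}_{\alpha_k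 r}\big(x^{(k)}-\alpha_k g^{(k)}+\beta_k(x^{(k)}-x^{(k-1)})\big),\qquad g^{(k)}=\tilde\nabla_k f(x^{(k-\tau_k)};\xi_k),$$ where $x^{(j)}:=x^{(1)}$ for $j\le0$. Let $T$ be drawn from $\{1,\dots,K\}$, independently of the samples and delays, with $\mathrm{Prob}(T=k)=\alpha_k/\sum_{j=1}^K\alpha_j$. Put $$\gamma=\tfrac12\Big(1-\tfrac{\alpha\rho}{2\sqrt K}-\tfrac{\beta}{K^{1/4}}\Big),\qquad B=\frac{\alpha}{\gamma\sqrt K}\big(\phi(x^{(1)})-\phi^*\big)+\frac{\alpha^2M^2}{\gamma^2}.$$ Then $\phi_{1/\bar\rho}$ is differentiable on $\mathbb R^n$, $\|\nabla\phi_{1/\bar\rho}(x^{(T)})\|^2$ is integrable, and $$\begin{aligned}\mathbb E\big\|\nabla\phi_{1/\bar\rho}(x^{(T)})\big\|^2\le\frac{2\bar\rho}{(\bar\rho-\rho)\alpha\sqrt K}\bigg[&\frac{\bar\rho}2\Big(2+\frac{2\sqrt K}{\alpha(\bar\rho-\rho)}\Big)\frac{\beta^2}{\sqrt K}B+4\bar\rho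 M^2\alpha^2\\&+\frac{\alpha\bar\rho\tau}{\sqrt K}\Big(\max\{0,-F(x^{(1)})\}+C_F+\tau\Big(\frac\rho2+\frac{\rho^2}{\bar\rho-\rho}\Big)B\Big)\\&+\phi_{1/\bar\rho}(x^{(1)})-\phi^*+M\alpha\bar\rho\tau\sqrt{B}\bigg].\end{aligned}$$ With all other quantities fixed, the right-hand side is $O(1/\sqrt K)$ as $K\to\infty$. -/

import Mathlib

open MeasureTheory ProbabilityTheory Filter Topology Asymptotics

noncomputable section

namespace InertialSubgradient

/-- `n`-dimensional real space with the Euclidean norm. -/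
abbrev Vec (n : ℕ) : Type := EuclideanSpace ℝ (Fin n)

/-- The subdifferential of `h` at `x`: all `v` such that
`h y ≥ h x + ⟪v, y - x⟫ + o(‖y - x‖)` as `y → x`. -/
def subdiff {n : ℕ} (h : Vec n → ℝ) (x : Vec n) : Set (Vec n) :=
  {v | ∀ ε : ℝ, 0 < ε → ∀ᶠ y in 𝓝 x, h x + inner ℝ v (y - x) - ε * ‖y - x‖ ≤ h y}

/-- `h` is `ρ`-weakly convex: `ρ > 0` and `h + (ρ/2)‖·‖²` is convex. -/
def WeaklyConvex {n : ℕ} (ρ : ℝ) (h : Vec n → ℝ) : Prop :=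
  0 < ρ ∧ ConvexOn ℝ Set.univ (fun x => h x + ρ / 2 * ‖x‖ ^ 2)

/-- The effective domain of an extended-real-valued function. -/
def effDom {n : ℕ} (r : Vec n → EReal) : Set (Vec n) := {x | r x < ⊤}

/-- `r : ℝⁿ → ℝ ∪ {+∞}` is convex and closed: it never takes the value `-∞`, its epigraph is
convex, and it is lower semicontinuous. -/
structure ClosedConvex {n : ℕ} (r : Vec n → EReal) : Prop where
  ne_bot : ∀ x, r x ≠ ⊥
  convex_epigraph : Convex ℝ {q : Vec n × ℝ | r q.1 ≤ (q.2 : EReal)}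
  lsc : LowerSemicontinuous r

/-- `y = prox_{c r}(z)`: `y` minimizes `r + (1/(2c)) ‖· - z‖²` over `ℝⁿ`. -/
def IsProx {n : ℕ} (c : ℝ) (r : Vec n → EReal) (z y : Vec n) : Prop :=
  ∀ w : Vec n,
    r y + ((1 / (2 * c) * ‖y - z‖ ^ 2 : ℝ) : EReal) ≤
      r w + ((1 / (2 * c) * ‖w - z‖ ^ 2 : ℝ) : EReal)

/-- `F(x) = E_ξ[f(x; ξ)]`, where `ξ` has law `μ`. -/
def expectedLoss {n : ℕ} {Ξ : Type*} [MeasurableSpace Ξ] (f : Vec n → Ξ → ℝ) (μ : Measure Ξ) :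
    Vec n → ℝ :=
  fun x => ∫ ξ, f x ξ ∂μ

/-- The composite objective `φ = F + r`. -/
def objective {n : ℕ} (F : Vec n → ℝ) (r : Vec n → EReal) : Vec n → EReal :=
  fun x => (F x : EReal) + r x

/-- The optimal value `φ* = inf φ`. -/
def optValue {n : ℕ} (φ : Vec n → EReal) : EReal := ⨅ x, φ x

/-- The Moreau envelope `φ_l(x) = inf_y { φ(y) + (1/(2l)) ‖y - x‖² }`. It is finite whenever `φ`
is bounded below and finite at some point, so nothing is lost by `toReal` there. -/
def moreauEnvelope {n : ℕ} (l : ℝ) (φ : Vec n → EReal) : Vec n → ℝ :=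
  fun x => (⨅ y, φ y + ((1 / (2 * l) * ‖y - x‖ ^ 2 : ℝ) : EReal)).toReal

/-- `g x ξ` is a measurable choice of a sample subgradient of `f(·; ξ)` at every `x ∈ dom r`. -/
structure IsSubgradientOracle {n : ℕ} {Ξ : Type*} [MeasurableSpace Ξ] (f : Vec n → Ξ → ℝ)
    (r : Vec n → EReal) (μ : Measure Ξ) (g : Vec n → Ξ → Vec n) : Prop where
  measurable : Measurable (Function.uncurry g)
  mem_subdiff : ∀ x ∈ effDom r, ∀ᵐ ξ ∂μ, g x ξ ∈ subdiff (fun y => f y ξ) x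

/-- The sample subgradients given by `g` are unbiased: `E_ξ[g(x; ξ)] ∈ ∂F(x)` on `dom r`. -/
def Unbiased {n : ℕ} {Ξ : Type*} [MeasurableSpace Ξ] (f : Vec n → Ξ → ℝ)
    (r : Vec n → EReal) (μ : Measure Ξ) (g : Vec n → Ξ → Vec n) : Prop :=
  ∀ x ∈ effDom r, ∫ ξ, g x ξ ∂μ ∈ subdiff (expectedLoss f μ) x

/-- For every `x ∈ dom r` and every measurable choice `s(ξ) ∈ ∂f(x; ξ)`, `E_ξ‖s(ξ)‖² ≤ M²`. -/
def BoundedSubgradients {n : ℕ} {Ξ : Type*} [MeasurableSpace Ξ] (f : Vec n → Ξ → ℝ)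
    (r : Vec n → EReal) (μ : Measure Ξ) (M : ℝ) : Prop :=
  ∀ x ∈ effDom r, ∀ s : Ξ → Vec n, Measurable s →
    (∀ᵐ ξ ∂μ, s ξ ∈ subdiff (fun y => f y ξ) x) →
    ∫⁻ ξ, ‖s ξ‖ₑ ^ 2 ∂μ ≤ ENNReal.ofReal (M ^ 2)

/-- `x⁽⁰⁾, x⁽¹⁾, …, x⁽ᴷ⁺¹⁾` are the iterates of `K` steps of the distributed stochastic inertial
subgradient method started at `x₀ ∈ dom r`, with stepsizes `a k`, inertial parameters `b k`,
samples `ξ k`, delays `d k`, and the rule `g k` that picks the sample subgradient in step `k`.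
Subtraction in `k - d k ω` is truncated, so a negative index is read as the starting point. -/
structure IsIterateSequence {n : ℕ} {Ξ Ω : Type*} (r : Vec n → EReal)
    (g : ℕ → Vec n → Ξ → Vec n) (a b : ℕ → ℝ) (ξ : ℕ → Ω → Ξ) (d : ℕ → Ω → ℕ)
    (K : ℕ) (x₀ : Vec n) (x : ℕ → Ω → Vec n) : Prop where
  start_mem : x₀ ∈ effDom r
  zero : ∀ ω, x 0 ω = x₀
  one : ∀ ω, x 1 ω = x₀
  step : ∀ k ∈ Set.Icc 1 K, ∀ ω,
    IsProx (a k) r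
      (x k ω - a k • g k (x (k - d k ω) ω) (ξ k ω) + b k • (x k ω - x (k - 1) ω))
      (x (k + 1) ω)

/-- The randomness in `K` steps: the samples `ξ k` have law `μ`, the delays `d k` take the value
`j ∈ {0, …, τ}` with probability `p j`, and the family of all `ξ k` and all `d k`,
`1 ≤ k ≤ K`, is mutually independent (the pairs are mutually independent, and so are the two
entries of each pair). -/
structure IsSampling {Ξ Ω : Type*} [MeasurableSpace Ξ] [MeasurableSpace Ω] (P : Measure Ω)
    (μ : Measure Ξ) (τ : ℕ) (p : ℕ → ℝ) (K : ℕ) (ξ : ℕ → Ω → Ξ) (d : ℕ → Ω → ℕ) : Prop where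
  measurable_sample : ∀ k ∈ Set.Icc 1 K, Measurable (ξ k)
  measurable_delay : ∀ k ∈ Set.Icc 1 K, Measurable (d k)
  law_sample : ∀ k ∈ Set.Icc 1 K, P.map (ξ k) = μ
  law_delay : ∀ k ∈ Set.Icc 1 K, ∀ j ≤ τ, P.real {ω | d k ω = j} = p j
  sum_law_delay : ∑ j ∈ Finset.range (τ + 1), p j = 1
  indep_steps : iIndepFun (fun (k : Set.Icc 1 K) ω => (ξ k ω, d k ω)) P
  indep_sample_delay : ∀ k ∈ Set.Icc 1 K, IndepFun (ξ k) (d k) P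

/-- `T` is drawn from `{1, …, K}`, independently of the samples and delays, with probability
proportional to the stepsizes `a k`. -/
structure IsRandomIndex {Ξ Ω : Type*} [MeasurableSpace Ξ] [MeasurableSpace Ω] (P : Measure Ω)
    (a : ℕ → ℝ) (K : ℕ) (ξ : ℕ → Ω → Ξ) (d : ℕ → Ω → ℕ) (T : Ω → ℕ) : Prop where
  measurable : Measurable T
  law : ∀ k ∈ Set.Icc 1 K, P.real {ω | T ω = k} = a k / ∑ j ∈ Finset.Icc 1 K, a j
  indep : IndepFun T (fun ω (k : Set.Icc 1 K) => (ξ k ω, d k ω)) P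

/-- `γ = (1/2) (1 - αρ/(2√K) - β/K^{1/4})`. -/
def gam (ρ α β : ℝ) (K : ℕ) : ℝ :=
  1 / 2 * (1 - α * ρ / (2 * √(K : ℝ)) - β / (K : ℝ) ^ (1 / 4 : ℝ))

/-- `α/(γ√K) (φ(x⁽¹⁾) - φ*) + α²M²/γ²`, with `φ₁` for `φ(x⁽¹⁾)` and `φs` for `φ*`. -/
def moveBound (ρ α β M φ₁ φs : ℝ) (K : ℕ) : ℝ :=
  α / (gam ρ α β K * √(K : ℝ)) * (φ₁ - φs) + α ^ 2 * M ^ 2 / gam ρ α β K ^ 2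

/-- The right-hand side of the rate, with `F₁` for `F(x⁽¹⁾)`, `φ₁` for `φ(x⁽¹⁾)`, `e₁` for the
Moreau envelope at `x⁽¹⁾`, and `φs` for `φ*`. -/
def rateBound (ρ ρ' α β M CF : ℝ) (τ : ℕ) (F₁ φ₁ e₁ φs : ℝ) (K : ℕ) : ℝ :=
  2 * ρ' / ((ρ' - ρ) * α * √(K : ℝ)) *
    (ρ' / 2 * (2 + 2 * √(K : ℝ) / (α * (ρ' - ρ))) * (β ^ 2 / √(K : ℝ)) *
        moveBound ρ α β M φ₁ φs K
      + 4 * ρ' * M ^ 2 * α ^ 2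
      + α * ρ' * τ / √(K : ℝ) *
        (max 0 (-F₁) + CF
          + τ * (ρ / 2 + ρ ^ 2 / (ρ' - ρ)) * moveBound ρ α β M φ₁ φs K)
      + (e₁ - φs)
      + M * α * ρ' * τ * √(moveBound ρ α β M φ₁ φs K))

end InertialSubgradient

end
open InertialSubgradient

/-!
Each step satisfies a descent inequality for the potential `a φ(x⁽ᵏ⁾) + (b/2) ‖x⁽ᵏ⁾ - x⁽ᵏ⁻¹⁾‖²`
with a gain proportional to `γ ‖x⁽ᵏ⁺¹⁾ - x⁽ᵏ⁾‖²`, and telescoping bounds the expected sum of the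
squared increments by `B`.

The Lyapunov function of the rate is the Moreau envelope of `φ`. Comparing `x⁽ᵏ⁺¹⁾` with the
proximal point `z` of `x⁽ᵏ⁾` decreases it by a multiple of `‖x⁽ᵏ⁾ - z‖²`, up to three errors. The
inertial term is an increment. The noise of the sample subgradient averages to zero, since the
fresh sample is independent of the past and of the delay. The delay costs a sum of at most `τ`
increments and a difference `F(x⁽ᵏ⁾) - F(x⁽ᵏ⁻ʲ⁾)` which telescopes over `k`. The claim follows
because the gradient of the envelope at `x⁽ᵏ⁾` is `ρ' (x⁽ᵏ⁾ - z)`.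
-/

noncomputable section

namespace InertialSubgradient

/-! ### Quadratic and first-order inequalities in inner product spaces -/

section InnerProductSpace

variable {V : Type*} [NormedAddCommGroup V] [InnerProductSpace ℝ V]

theorem norm_add_smul_sq (u w : V) (t : ℝ) :
    ‖u + t • w‖ ^ 2 = ‖u‖ ^ 2 + 2 * t * inner ℝ u w + t ^ 2 * ‖w‖ ^ 2 := by
  rw [norm_add_sq_real, inner_smul_right, norm_smul, mul_pow, Real.norm_eq_abs, sq_abs]
  ring

theorem norm_add_sq_le_two (u w : V) : ‖u + w‖ ^ 2 ≤ 2 * (‖u‖ ^ 2 + ‖w‖ ^ 2) := by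
  have := parallelogram_law_with_norm ℝ u w
  nlinarith [mul_self_nonneg ‖u - w‖]

theorem norm_sub_sq_le_two (u w : V) : ‖u - w‖ ^ 2 ≤ 2 * (‖u‖ ^ 2 + ‖w‖ ^ 2) := by
  simpa only [sub_eq_add_neg, norm_neg] using norm_add_sq_le_two u (-w)

theorem norm_sub_sq_le_of_norm_le {M : ℝ} {u : V} (hu : ‖u‖ ≤ M) (w : V) :
    ‖u - w‖ ^ 2 ≤ 2 * (‖w‖ ^ 2 + M ^ 2) := by
  nlinarith [norm_sub_sq_le_two u w, norm_nonneg u]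

theorem two_mul_inner_le {ε : ℝ} (hε : 0 < ε) (u w : V) :
    2 * inner ℝ u w ≤ ε * ‖u‖ ^ 2 + ε⁻¹ * ‖w‖ ^ 2 := by
  linarith [real_inner_le_norm u w, two_mul_le_add_mul_sq (a := ‖u‖) (b := ‖w‖) hε]

theorem norm_smul_add_add_sq_le {ε : ℝ} (hε : 0 < ε) (t : ℝ) (u e δ : V) :
    ‖t • u + (e + δ)‖ ^ 2 ≤ (1 + ε) * (t ^ 2 * ‖u‖ ^ 2) + (2 + ε⁻¹) * ‖δ‖ ^ 2
      + 2 * ‖e‖ ^ 2 + 2 * t * inner ℝ u e := by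
  have hcross := two_mul_inner_le hε (t • u) δ
  have herror := norm_add_sq_le_two e δ
  have hsmul : ‖t • u‖ ^ 2 = t ^ 2 * ‖u‖ ^ 2 := by
    rw [norm_smul, mul_pow, Real.norm_eq_abs, sq_abs]
  rw [norm_add_sq_real, inner_add_right, real_inner_smul_left, hsmul]
  rw [hsmul] at hcross
  linarith

theorem hasGradientAt_of_abs_sub_le_sq [CompleteSpace V] {f : V → ℝ} {v x : V} {C : ℝ}
    (hf : ∀ y, |f y - f x - inner ℝ v (y - x)| ≤ C * ‖y - x‖ ^ 2) : HasGradientAt f v x := by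
  rw [hasGradientAt_iff_isLittleO]
  have hO : (fun y => f y - f x - inner ℝ v (y - x)) =O[𝓝 x] fun y => ‖y - x‖ ^ 2 :=
    IsBigO.of_bound C (Eventually.of_forall fun y => by
      simpa only [Real.norm_eq_abs, abs_pow, abs_norm] using hf y)
  exact hO.trans_isLittleO (isLittleO_pow_sub_sub x one_lt_two)

theorem le_along_segment_of_strongConvexOn {s : Set V} {f : V → ℝ} {m : ℝ}
    (hf : StrongConvexOn s m f) {x y : V} (hx : x ∈ s) (hy : y ∈ s) {t : ℝ}
    (ht : t ∈ Set.Ioo (0 : ℝ) 1) :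
    f (x + t • (y - x)) ≤ (1 - t) * f x + t * f y - t * (1 - t) * (m / 2 * ‖y - x‖ ^ 2) := by
  have h := hf.2 hx hy (sub_nonneg.2 ht.2.le) ht.1.le (sub_add_cancel 1 t)
  have e : (1 - t) • x + t • y = x + t • (y - x) := by module
  simp only [e, smul_eq_mul, norm_sub_rev x y] at h
  linarith

theorem add_smul_sub_mem_of_strongConvexOn {s : Set V} {f : V → ℝ} {m : ℝ}
    (hf : StrongConvexOn s m f) {x y : V} (hx : x ∈ s) (hy : y ∈ s) {t : ℝ}
    (ht : t ∈ Set.Ioo (0 : ℝ) 1) : x + t • (y - x) ∈ s :=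
  hf.1.add_smul_sub_mem hx hy ⟨ht.1.le, ht.2.le⟩

theorem add_slope_le_of_strongConvexOn {s : Set V} {f : V → ℝ} {m e : ℝ}
    (hf : StrongConvexOn s m f) {x y : V} (hx : x ∈ s) (hy : y ∈ s)
    (hslope : ∀ ε > 0, ∀ᶠ t in 𝓝[>] (0 : ℝ), f x + t * (e - ε) ≤ f (x + t • (y - x))) :
    f x + e + m / 2 * ‖y - x‖ ^ 2 ≤ f y := by
  refine le_of_forall_pos_le_add fun ε hε => ?_
  have hlim : Tendsto (fun t : ℝ => f x + e + (1 - t) * (m / 2 * ‖y - x‖ ^ 2)) (𝓝[>] 0)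
      (𝓝 (f x + e + (1 - 0) * (m / 2 * ‖y - x‖ ^ 2))) :=
    (Continuous.tendsto (by fun_prop) 0).mono_left nhdsWithin_le_nhds
  rw [sub_zero, one_mul] at hlim
  refine le_of_tendsto hlim ?_
  filter_upwards [hslope ε hε, Ioo_mem_nhdsGT (zero_lt_one' ℝ)] with t hlow ht
  have hup := le_along_segment_of_strongConvexOn hf hx hy ht
  refine le_of_mul_le_mul_left ?_ ht.1
  linarith

end InnerProductSpace

theorem exists_forall_le_of_lowerSemicontinuous {X β : Type*} [TopologicalSpace X] [LinearOrder β]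
    {f : X → β} (hf : LowerSemicontinuous f) (x₀ : X)
    (hx₀ : ∀ᶠ x in cocompact X, f x₀ ≤ f x) : ∃ x, ∀ y, f x ≤ f y := by
  obtain ⟨s, hs, hsub⟩ := mem_cocompact.1 hx₀
  obtain ⟨x, -, hx⟩ := (hf.lowerSemicontinuousOn (insert x₀ s)).exists_isMinOn
    (Set.insert_nonempty x₀ s) (hs.insert x₀)
  refine ⟨x, fun y => ?_⟩
  by_cases hy : y ∈ s
  · exact hx (Set.mem_insert_of_mem x₀ hy)
  · exact (hx (Set.mem_insert x₀ s)).trans (hsub hy)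

theorem lowerSemicontinuous_coe_add {X : Type*} [TopologicalSpace X] {u : X → ℝ} {h : X → EReal}
    (hu : Continuous u) (hh : LowerSemicontinuous h) :
    LowerSemicontinuous fun x => (u x : EReal) + h x :=
  LowerSemicontinuous.add' (continuous_coe_real_ereal.comp hu).lowerSemicontinuous hh fun _ =>
    EReal.continuousAt_add (Or.inl (EReal.coe_ne_top _)) (Or.inl (EReal.coe_ne_bot _))

/-! ### Weak convexity

A `ρ`-weakly convex function is treated as a `(-ρ)`-strongly convex one in the sense of
`StrongConvexOn`. -/

section WeakConvexity

variable {n : ℕ} {ρ : ℝ} {F : Vec n → ℝ} {h r : Vec n → EReal}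

theorem WeaklyConvex.strongConvexOn (hF : WeaklyConvex ρ F) :
    StrongConvexOn Set.univ (-ρ) F := by
  simpa only [strongConvexOn_iff_convex, neg_div, neg_mul, sub_neg_eq_add] using hF.2

theorem WeaklyConvex.continuous (hF : WeaklyConvex ρ F) : Continuous F := by
  have hsum : Continuous fun x => F x + ρ / 2 * ‖x‖ ^ 2 := hF.2.locallyLipschitz.continuous
  exact (hsum.sub (by fun_prop : Continuous fun x : Vec n => ρ / 2 * ‖x‖ ^ 2)).congr fun x =>
    add_sub_cancel_right (F x) _

theorem le_of_mem_subdiff (hF : StrongConvexOn Set.univ (-ρ) F) {x v : Vec n}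
    (hv : v ∈ subdiff F x) (y : Vec n) :
    F x + inner ℝ v (y - x) - ρ / 2 * ‖y - x‖ ^ 2 ≤ F y := by
  have hsegment : Tendsto (fun t : ℝ => x + t • (y - x)) (𝓝[>] 0) (𝓝 x) := by
    have : Tendsto (fun t : ℝ => x + t • (y - x)) (𝓝 0) (𝓝 (x + (0 : ℝ) • (y - x))) :=
      Continuous.tendsto (by fun_prop) _
    rw [zero_smul, add_zero] at this
    exact this.mono_left nhdsWithin_le_nhds
  have hslope : ∀ ε > 0, ∀ᶠ t in 𝓝[>] (0 : ℝ),
      F x + t * (inner ℝ v (y - x) - ε) ≤ F (x + t • (y - x)) := by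
    intro ε hε
    have hscaled : ε / (‖y - x‖ + 1) * ‖y - x‖ ≤ ε := by
      rw [div_mul_eq_mul_div, div_le_iff₀ (by positivity)]
      linarith
    filter_upwards [hsegment.eventually (hv (ε / (‖y - x‖ + 1)) (by positivity)),
      self_mem_nhdsWithin] with t ht htpos
    rw [add_sub_cancel_left, inner_smul_right, norm_smul, Real.norm_of_nonneg (le_of_lt htpos)]
      at ht
    nlinarith [mul_le_mul_of_nonneg_left hscaled (le_of_lt htpos)]
  have := add_slope_le_of_strongConvexOn hF (Set.mem_univ x) (Set.mem_univ y) hslope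
  linarith

theorem coe_toReal_of_mem_effDom (hbot : ∀ x, h x ≠ ⊥) {x : Vec n} (hx : x ∈ effDom h) :
    ((h x).toReal : EReal) = h x :=
  EReal.coe_toReal (ne_of_lt hx) (hbot x)

theorem ClosedConvex.convexOn_toReal (hr : ClosedConvex r) :
    ConvexOn ℝ (effDom r) fun x => (r x).toReal := by
  have hsegment : ∀ x ∈ effDom r, ∀ y ∈ effDom r, ∀ a b : ℝ, 0 ≤ a → 0 ≤ b → a + b = 1 →
      r (a • x + b • y) ≤ ((a * (r x).toReal + b * (r y).toReal : ℝ) : EReal) := by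
    intro x hx y hy a b ha hb hab
    exact hr.convex_epigraph (x := (x, (r x).toReal)) (coe_toReal_of_mem_effDom hr.ne_bot hx).ge
      (y := (y, (r y).toReal)) (coe_toReal_of_mem_effDom hr.ne_bot hy).ge ha hb hab
  have hmem : ∀ x ∈ effDom r, ∀ y ∈ effDom r, ∀ a b : ℝ, 0 ≤ a → 0 ≤ b → a + b = 1 →
      a • x + b • y ∈ effDom r := fun x hx y hy a b ha hb hab =>
    (hsegment x hx y hy a b ha hb hab).trans_lt (EReal.coe_lt_top _)
  refine ⟨fun x hx y hy a b ha hb hab => hmem x hx y hy a b ha hb hab,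
    fun x hx y hy a b ha hb hab => ?_⟩
  rw [← EReal.coe_le_coe_iff,
    coe_toReal_of_mem_effDom hr.ne_bot (hmem x hx y hy a b ha hb hab)]
  exact hsegment x hx y hy a b ha hb hab

end WeakConvexity

/-! ### The composite objective -/

section Objective

variable {n : ℕ} {ρ : ℝ} {F : Vec n → ℝ} {r φ : Vec n → EReal} {x : Vec n}

theorem effDom_objective (F : Vec n → ℝ) (r : Vec n → EReal) :
    effDom (objective F r) = effDom r := by
  ext x
  simp only [effDom, objective, Set.mem_ofPred_eq, lt_top_iff_ne_top]
  exact EReal.add_ne_top_iff_ne_top_right (EReal.coe_ne_bot _) (EReal.coe_ne_top _)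

theorem objective_ne_bot (F : Vec n → ℝ) (hr : ∀ x, r x ≠ ⊥) (x : Vec n) :
    objective F r x ≠ ⊥ :=
  EReal.add_ne_bot_iff.2 ⟨EReal.coe_ne_bot _, hr x⟩

theorem toReal_objective (F : Vec n → ℝ) (hr : ∀ x, r x ≠ ⊥) (hx : x ∈ effDom r) :
    (objective F r x).toReal = F x + (r x).toReal := by
  rw [objective, EReal.toReal_add (EReal.coe_ne_top _) (EReal.coe_ne_bot _) (ne_of_lt hx) (hr x),
    EReal.toReal_coe]

theorem strongConvexOn_objective (hF : StrongConvexOn Set.univ (-ρ) F) (hr : ClosedConvex r) :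
    StrongConvexOn (effDom (objective F r)) (-ρ) fun x => (objective F r x).toReal := by
  rw [effDom_objective]
  have hconv := hr.convexOn_toReal
  refine ⟨hconv.1, fun x hx y hy a b ha hb hab => ?_⟩
  have hFle := hF.2 (Set.mem_univ x) (Set.mem_univ y) ha hb hab
  have hrle := hconv.2 hx hy ha hb hab
  simp only [smul_eq_mul, toReal_objective F hr.ne_bot hx, toReal_objective F hr.ne_bot hy,
    toReal_objective F hr.ne_bot (hconv.1 hx hy ha hb hab)] at hFle hrle ⊢
  linarith

theorem coe_toReal_optValue (hbdd : optValue φ ≠ ⊥) (hx : x ∈ effDom φ) :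
    ((optValue φ).toReal : EReal) = optValue φ :=
  EReal.coe_toReal (ne_of_lt ((iInf_le φ x).trans_lt hx)) hbdd

theorem toReal_optValue_le (hbdd : optValue φ ≠ ⊥) (hx : x ∈ effDom φ) :
    (optValue φ).toReal ≤ (φ x).toReal :=
  EReal.toReal_le_toReal (iInf_le φ x) hbdd (ne_of_lt hx)

theorem toReal_optValue_sub_le (hr : ∀ x, r x ≠ ⊥) (hbdd : optValue (objective F r) ≠ ⊥) {C : ℝ}
    (hC : ∀ x ∈ effDom r, F x ≤ C) (x : Vec n) :
    (((optValue (objective F r)).toReal - C : ℝ) : EReal) ≤ r x := by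
  by_cases hx : x ∈ effDom r
  · have hle := toReal_optValue_le hbdd ((effDom_objective F r).symm ▸ hx)
    rw [toReal_objective F hr hx] at hle
    rw [← coe_toReal_of_mem_effDom hr hx, EReal.coe_le_coe_iff]
    linarith [hC x hx]
  · exact le_top.trans (not_lt.1 hx)

end Objective

/-! ### Proximal points -/

section Prox

variable {n : ℕ} {h : Vec n → EReal} {c ρ : ℝ} {z z' y y' w : Vec n}

theorem IsProx.mem_effDom (hp : IsProx c h z y) (hw : w ∈ effDom h) : y ∈ effDom h := by
  have hlt := (hp w).trans_lt (EReal.add_lt_top (ne_of_lt hw) (EReal.coe_ne_top _))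
  refine Ne.lt_top (α := EReal) fun htop => ?_
  rw [htop, EReal.top_add_coe] at hlt
  exact lt_irrefl _ hlt

theorem IsProx.toReal_le (hbot : ∀ x, h x ≠ ⊥) (hp : IsProx c h z y) (hw : w ∈ effDom h) :
    (h y).toReal + 1 / (2 * c) * ‖y - z‖ ^ 2 ≤ (h w).toReal + 1 / (2 * c) * ‖w - z‖ ^ 2 := by
  have hle := hp w
  rw [← coe_toReal_of_mem_effDom hbot hw,
    ← coe_toReal_of_mem_effDom hbot (hp.mem_effDom hw)] at hle
  exact_mod_cast hle

theorem IsProx.toReal_le_along_segment (hbot : ∀ x, h x ≠ ⊥) (hp : IsProx c h z y) {t : ℝ}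
    (ht : y + t • (w - y) ∈ effDom h) :
    (h y).toReal + t * (1 / c * inner ℝ (z - y) (w - y) - 1 / (2 * c) * ‖w - y‖ ^ 2 * t) ≤
      (h (y + t • (w - y))).toReal := by
  have hle := hp.toReal_le hbot ht
  have hvec : y + t • (w - y) - z = (y - z) + t • (w - y) := by abel
  have hinner : inner ℝ (y - z) (w - y) = -inner ℝ (z - y) (w - y) := by
    rw [← inner_neg_left, neg_sub]
  have hhalf : 1 / c = 2 * (1 / (2 * c)) := by ring
  rw [hvec, norm_add_smul_sq, hinner] at hle
  rw [hhalf]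
  linarith

theorem IsProx.variational (hbot : ∀ x, h x ≠ ⊥)
    (hconv : StrongConvexOn (effDom h) (-ρ) fun x => (h x).toReal) (hp : IsProx c h z y)
    (hw : w ∈ effDom h) :
    (h y).toReal + 1 / c * inner ℝ (z - y) (w - y) - ρ / 2 * ‖w - y‖ ^ 2 ≤ (h w).toReal := by
  have hy := hp.mem_effDom hw
  have hslope : ∀ ε > 0, ∀ᶠ t in 𝓝[>] (0 : ℝ),
      (h y).toReal + t * (1 / c * inner ℝ (z - y) (w - y) - ε) ≤
        (h (y + t • (w - y))).toReal := by
    intro ε hε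
    have hsmall : ∀ᶠ t in 𝓝[>] (0 : ℝ), 1 / (2 * c) * ‖w - y‖ ^ 2 * t < ε :=
      nhdsWithin_le_nhds ((Continuous.tendsto' (by fun_prop) _ _ (mul_zero _)).eventually_lt_const
        hε)
    filter_upwards [hsmall, Ioo_mem_nhdsGT (zero_lt_one' ℝ)] with t htε ht
    have hle := hp.toReal_le_along_segment hbot
      (add_smul_sub_mem_of_strongConvexOn hconv hy hw ht)
    nlinarith [mul_le_mul_of_nonneg_left htε.le ht.1.le]
  have := add_slope_le_of_strongConvexOn hconv hy hw hslope
  linarith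

theorem IsProx.mul_sq_norm_sub_le (hbot : ∀ x, h x ≠ ⊥)
    (hconv : StrongConvexOn (effDom h) (-ρ) fun x => (h x).toReal) (hw : w ∈ effDom h)
    (hp : IsProx c h z y) (hp' : IsProx c h z' y') :
    (1 / c - ρ) * ‖y - y'‖ ^ 2 ≤ 1 / c * inner ℝ (z - z') (y - y') := by
  have hle := hp.variational hbot hconv (hp'.mem_effDom hw)
  have hle' := hp'.variational hbot hconv (hp.mem_effDom hw)
  have hsum : inner ℝ (z - y) (y' - y) + inner ℝ (z' - y') (y - y') =
      ‖y - y'‖ ^ 2 - inner ℝ (z - z') (y - y') := by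
    rw [← real_inner_self_eq_norm_sq, ← neg_sub y y', inner_neg_right, ← sub_eq_neg_add,
      ← inner_sub_left, ← inner_sub_left]
    congr 1
    abel
  rw [norm_sub_rev y' y] at hle
  linear_combination hle + hle' - 1 / c * hsum

theorem IsProx.norm_sub_le (hbot : ∀ x, h x ≠ ⊥)
    (hconv : StrongConvexOn (effDom h) (-ρ) fun x => (h x).toReal) (hw : w ∈ effDom h)
    (hc : 0 < c) (hcρ : ρ < 1 / c) (hp : IsProx c h z y) (hp' : IsProx c h z' y') :
    ‖y - y'‖ ≤ 1 / c / (1 / c - ρ) * ‖z - z'‖ := by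
  have hpos : 0 < 1 / c - ρ := sub_pos.2 hcρ
  rcases (norm_nonneg (y - y')).eq_or_lt with hzero | hnorm
  · rw [← hzero]; positivity
  rw [div_mul_eq_mul_div, le_div_iff₀ hpos]
  refine le_of_mul_le_mul_right ?_ hnorm
  calc ‖y - y'‖ * (1 / c - ρ) * ‖y - y'‖ = (1 / c - ρ) * ‖y - y'‖ ^ 2 := by ring
    _ ≤ 1 / c * inner ℝ (z - z') (y - y') := hp.mul_sq_norm_sub_le hbot hconv hw hp'
    _ ≤ 1 / c * (‖z - z'‖ * ‖y - y'‖) := by gcongr; exact real_inner_le_norm _ _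
    _ = 1 / c * ‖z - z'‖ * ‖y - y'‖ := (mul_assoc _ _ _).symm

theorem exists_isProx (hlsc : LowerSemicontinuous h) {m : ℝ} (hm : ∀ x, (m : EReal) ≤ h x)
    (hw : w ∈ effDom h) (hc : 0 < c) (z : Vec n) : ∃ y, IsProx c h z y := by
  have hbot : ∀ x, h x ≠ ⊥ := fun x => ne_of_gt ((EReal.bot_lt_coe m).trans_le (hm x))
  have hlsc' := lowerSemicontinuous_coe_add
    (by fun_prop : Continuous fun y : Vec n => 1 / (2 * c) * ‖y - z‖ ^ 2) hlsc
  simp only [add_comm _ (h _)] at hlsc'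
  refine exists_forall_le_of_lowerSemicontinuous hlsc' w ?_
  have hcoercive : Tendsto (fun y : Vec n => 1 / (2 * c) * ‖y - z‖ ^ 2) (cocompact _) atTop := by
    simp only [← dist_eq_norm]
    exact ((tendsto_pow_atTop two_ne_zero).comp
      (tendsto_dist_right_cocompact_atTop z)).const_mul_atTop (by positivity)
  filter_upwards [hcoercive.eventually_ge_atTop
    ((h w).toReal + 1 / (2 * c) * ‖w - z‖ ^ 2 - m)] with y hy
  calc h w + ((1 / (2 * c) * ‖w - z‖ ^ 2 : ℝ) : EReal)
      = (((h w).toReal + 1 / (2 * c) * ‖w - z‖ ^ 2 : ℝ) : EReal) := by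
        rw [EReal.coe_add, coe_toReal_of_mem_effDom hbot hw]
    _ ≤ ((m + 1 / (2 * c) * ‖y - z‖ ^ 2 : ℝ) : EReal) := EReal.coe_le_coe_iff.2 (by linarith)
    _ ≤ h y + ((1 / (2 * c) * ‖y - z‖ ^ 2 : ℝ) : EReal) := by
        rw [EReal.coe_add]
        exact add_le_add_left (hm y) _

end Prox

/-! ### The Moreau envelope -/

section Moreau

variable {n : ℕ} {φ : Vec n → EReal} {l ρ : ℝ} {x y z w : Vec n}

theorem IsProx.moreauEnvelope_eq (hbot : ∀ x, φ x ≠ ⊥) (hw : w ∈ effDom φ)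
    (hp : IsProx l φ x y) :
    moreauEnvelope l φ x = (φ y).toReal + 1 / (2 * l) * ‖y - x‖ ^ 2 := by
  have hinf : (⨅ w, φ w + ((1 / (2 * l) * ‖w - x‖ ^ 2 : ℝ) : EReal)) =
      φ y + ((1 / (2 * l) * ‖y - x‖ ^ 2 : ℝ) : EReal) :=
    le_antisymm (iInf_le _ y) (le_iInf hp)
  rw [moreauEnvelope, hinf, ← coe_toReal_of_mem_effDom hbot (hp.mem_effDom hw), ← EReal.coe_add,
    EReal.toReal_coe, EReal.toReal_coe]

theorem IsProx.moreauEnvelope_le (hbot : ∀ x, φ x ≠ ⊥) (hp : IsProx l φ x y)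
    (hw : w ∈ effDom φ) :
    moreauEnvelope l φ x ≤ (φ w).toReal + 1 / (2 * l) * ‖w - x‖ ^ 2 := by
  rw [hp.moreauEnvelope_eq hbot hw]
  exact hp.toReal_le hbot hw

theorem IsProx.moreauEnvelope_sub_le (hbot : ∀ x, φ x ≠ ⊥) (hw : w ∈ effDom φ)
    (hp : IsProx l φ x y) {x' y' : Vec n} (hp' : IsProx l φ x' y') :
    moreauEnvelope l φ x' - moreauEnvelope l φ x ≤
      1 / l * inner ℝ (x - y) (x' - x) + 1 / (2 * l) * ‖x' - x‖ ^ 2 := by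
  have hle := hp'.moreauEnvelope_le hbot (hp.mem_effDom hw)
  have hexpand : ‖y - x'‖ ^ 2 = ‖y - x‖ ^ 2 + 2 * inner ℝ (x - y) (x' - x) + ‖x' - x‖ ^ 2 := by
    rw [← sub_sub_sub_cancel_right y x' x, norm_sub_sq_real, ← neg_sub x y, inner_neg_left,
      norm_neg]
    ring
  rw [hp.moreauEnvelope_eq hbot hw]
  rw [hexpand] at hle
  linear_combination hle

theorem hasGradientAt_moreauEnvelope (hbot : ∀ x, φ x ≠ ⊥)
    (hconv : StrongConvexOn (effDom φ) (-ρ) fun x => (φ x).toReal) (hw : w ∈ effDom φ)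
    (hl : 0 < l) (hlρ : ρ < 1 / l) {pr : Vec n → Vec n} (hpr : ∀ x, IsProx l φ x (pr x))
    (x : Vec n) : HasGradientAt (moreauEnvelope l φ) ((1 / l) • (x - pr x)) x := by
  set L : ℝ := 1 / l / (1 / l - ρ)
  have hL : 0 ≤ L := div_nonneg (by positivity) (sub_nonneg.2 hlρ.le)
  refine hasGradientAt_of_abs_sub_le_sq (C := 1 / l * (1 + L)) fun y => ?_
  have hlip : inner ℝ (pr y - pr x) (y - x) ≤ L * ‖y - x‖ ^ 2 :=
    calc inner ℝ (pr y - pr x) (y - x) ≤ ‖pr y - pr x‖ * ‖y - x‖ := real_inner_le_norm _ _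
      _ ≤ L * ‖y - x‖ * ‖y - x‖ := by
        gcongr
        exact (hpr y).norm_sub_le hbot hconv hw hl hlρ (hpr x)
      _ = L * ‖y - x‖ ^ 2 := by ring
  have hup := (hpr x).moreauEnvelope_sub_le hbot hw (hpr y)
  have hdown := (hpr y).moreauEnvelope_sub_le hbot hw (hpr x)
  have hexpand : inner ℝ (y - pr y) (x - y) =
      -inner ℝ (x - pr x) (y - x) - ‖y - x‖ ^ 2 + inner ℝ (pr y - pr x) (y - x) := by
    rw [← real_inner_self_eq_norm_sq, ← neg_sub y x, inner_neg_right, ← inner_neg_left,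
      ← inner_neg_left, ← inner_sub_left, ← inner_add_left]
    congr 1
    abel
  have hhalf : 1 / (2 * l) = 1 / 2 * (1 / l) := by ring
  rw [hexpand, norm_sub_rev x y, hhalf] at hdown
  rw [hhalf] at hup
  have hlip' := mul_le_mul_of_nonneg_left hlip (one_div_pos.2 hl).le
  have hsq : 0 ≤ 1 / l * ‖y - x‖ ^ 2 := by positivity
  have hLsq : 0 ≤ 1 / l * (L * ‖y - x‖ ^ 2) :=
    mul_nonneg (by positivity) (mul_nonneg hL (sq_nonneg _))
  rw [real_inner_smul_left, abs_le]
  constructor <;> linarith [hsq, hLsq]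

end Moreau

/-! ### Subgradients at a proximal point of the objective -/

section LimitingSubgradient

variable {n : ℕ} {F : Vec n → ℝ} {r : Vec n → EReal} {ρ M c : ℝ} {x q y : Vec n}

theorem IsProx.le_add_inner_subgradient_along_segment
    (hF : StrongConvexOn Set.univ (-ρ) F) (hr : ClosedConvex r)
    (hq : IsProx c (objective F r) x q) (hy : y ∈ effDom r) {s : ℝ}
    (hs : s ∈ Set.Ioo (0 : ℝ) 1) {v : Vec n} (hv : v ∈ subdiff F (q + s • (y - q))) :
    (r q).toReal + 1 / c * inner ℝ (x - q) (y - q) ≤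
      (r y).toReal + inner ℝ v (y - q) + (ρ / 2 + 1 / (2 * c)) * ‖y - q‖ ^ 2 * s := by
  have hdom := effDom_objective F r
  have hqr : q ∈ effDom r := hdom ▸ hq.mem_effDom (hdom.symm ▸ hy)
  have hconv := strongConvexOn_zero.2 hr.convexOn_toReal
  have hmem := add_smul_sub_mem_of_strongConvexOn hconv hqr hy hs
  have hrle := le_along_segment_of_strongConvexOn hconv hqr hy hs
  have hprox := hq.toReal_le_along_segment (objective_ne_bot F hr.ne_bot) (hdom.symm ▸ hmem)
  rw [toReal_objective F hr.ne_bot hqr, toReal_objective F hr.ne_bot hmem] at hprox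
  have hFle := le_of_mem_subdiff hF hv q
  rw [sub_add_cancel_left, inner_neg_right, inner_smul_right, norm_neg, norm_smul, mul_pow,
    Real.norm_eq_abs, sq_abs] at hFle
  refine le_of_mul_le_mul_left (a := s) ?_ hs.1
  linear_combination hprox + hFle + hrle

theorem exists_bounded_subgradient (hF : WeaklyConvex ρ F) (hr : ClosedConvex r)
    {G : Vec n → Vec n} (hG : ∀ x ∈ effDom r, G x ∈ subdiff F x)
    (hGM : ∀ x ∈ effDom r, ‖G x‖ ≤ M) (hq : IsProx c (objective F r) x q)
    (hy : y ∈ effDom r) :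
    ∃ v : Vec n, ‖v‖ ≤ M ∧ (∀ z, F q + inner ℝ v (z - q) - ρ / 2 * ‖z - q‖ ^ 2 ≤ F z) ∧
      (r q).toReal + 1 / c * inner ℝ (x - q) (y - q) ≤ (r y).toReal + inner ℝ v (y - q) := by
  have hdom := effDom_objective F r
  have hqr : q ∈ effDom r := hdom ▸ hq.mem_effDom (hdom.symm ▸ hy)
  obtain ⟨t, -, ht, htlim⟩ := exists_seq_strictAnti_tendsto' (zero_lt_one' ℝ)
  have hmem k : q + t k • (y - q) ∈ effDom r :=
    add_smul_sub_mem_of_strongConvexOn (strongConvexOn_zero.2 hr.convexOn_toReal) hqr hy (ht k)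
  have hplim : Tendsto (fun k => q + t k • (y - q)) atTop (𝓝 q) := by
    simpa using tendsto_const_nhds (x := q) |>.add (htlim.smul_const (y - q))
  -- `v` is a limit of subgradients at points of the segment that approach `q`.
  obtain ⟨v, hv, ψ, hψ, hlim⟩ := (isCompact_closedBall (0 : Vec n) M).tendsto_subseq
    (x := fun k => G (q + t k • (y - q))) fun k => mem_closedBall_zero_iff.2 (hGM _ (hmem k))
  refine ⟨v, mem_closedBall_zero_iff.1 hv, fun z => ?_, ?_⟩
  · have hpψ := hplim.comp hψ.tendsto_atTop
    have hzp := tendsto_const_nhds (x := z) |>.sub hpψ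
    exact le_of_tendsto' ((((hF.continuous.tendsto q).comp hpψ).add (hlim.inner hzp)).sub
      ((hzp.norm.pow 2).const_mul _)) fun k =>
        le_of_mem_subdiff hF.strongConvexOn (hG _ (hmem _)) z
  · have hbound := ((hlim.inner (tendsto_const_nhds (x := y - q))).const_add (r y).toReal).add
      ((htlim.comp hψ.tendsto_atTop).const_mul ((ρ / 2 + 1 / (2 * c)) * ‖y - q‖ ^ 2))
    rw [mul_zero, add_zero] at hbound
    exact ge_of_tendsto' hbound fun k => hq.le_add_inner_subgradient_along_segment
      hF.strongConvexOn hr hy (ht _) (hG _ (hmem _))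

end LimitingSubgradient

/-! ### One step of the method -/

section Step

variable {n : ℕ} {F : Vec n → ℝ} {r : Vec n → EReal} {ρ ρ' M a b : ℝ} {G : Vec n → Vec n}

theorem IsProx.mul_toReal_add_inner_le (hr : ClosedConvex r) (ha : 0 < a) {z y w : Vec n}
    (hp : IsProx a r z y) (hw : w ∈ effDom r) :
    a * (r y).toReal + inner ℝ (z - y) (w - y) ≤ a * (r w).toReal := by
  have hle := hp.variational (ρ := 0) hr.ne_bot
    (by simpa only [neg_zero, strongConvexOn_zero] using hr.convexOn_toReal) hw
  rw [zero_div, zero_mul, sub_zero] at hle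
  calc a * (r y).toReal + inner ℝ (z - y) (w - y)
      = a * ((r y).toReal + 1 / a * inner ℝ (z - y) (w - y)) := by field_simp
    _ ≤ a * (r w).toReal := by gcongr

theorem potential_step_le (hF : WeaklyConvex ρ F) (hr : ClosedConvex r) {γ : ℝ} (ha : 0 < a)
    (hb : 0 ≤ b) (hγ : 0 < γ) (hγ2 : 2 * γ = 1 - a * ρ / 2 - b) {x x' xₚ g v : Vec n}
    (hx : x ∈ effDom r) (hstep : IsProx a r (x - a • g + b • (x - xₚ)) x')
    (hv : v ∈ subdiff F x') (hvM : ‖v‖ ≤ M) :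
    a * (objective F r x').toReal + (γ + b / 2) * ‖x' - x‖ ^ 2 ≤
      a * (objective F r x).toReal + b / 2 * ‖x - xₚ‖ ^ 2
        + a ^ 2 / (2 * γ) * (‖g‖ ^ 2 + M ^ 2) := by
  rw [toReal_objective F hr.ne_bot hx, toReal_objective F hr.ne_bot (hstep.mem_effDom hx)]
  have hFle := le_of_mem_subdiff hF.strongConvexOn hv x
  have hrle := hstep.mul_toReal_add_inner_le hr ha hx
  set D := x' - x with hD
  have hback : x - x' = -D := by rw [hD, neg_sub]
  have hresidual : x - a • g + b • (x - xₚ) - x' = -D - a • g + b • (x - xₚ) := by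
    rw [hD]; abel
  rw [hresidual, hback, inner_neg_right, inner_add_left, inner_sub_left, inner_neg_left,
    real_inner_smul_left, real_inner_smul_left, real_inner_self_eq_norm_sq] at hrle
  rw [hback, inner_neg_right, norm_neg] at hFle
  have hinertia : inner ℝ (x - xₚ) D ≤ 1 / 2 * (‖x - xₚ‖ ^ 2 + ‖D‖ ^ 2) := by
    linarith [two_mul_inner_le one_pos (x - xₚ) D]
  have hnoise : a * inner ℝ (v - g) D ≤ γ * ‖D‖ ^ 2 + a ^ 2 / (2 * γ) * (‖g‖ ^ 2 + M ^ 2) := by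
    have hyoung := two_mul_inner_le (mul_pos two_pos hγ) D (a • (v - g))
    rw [inner_smul_right, real_inner_comm, norm_smul, mul_pow, Real.norm_eq_abs, sq_abs] at hyoung
    have hvg := mul_le_mul_of_nonneg_left (norm_sub_sq_le_of_norm_le hvM g)
      (by positivity : 0 ≤ a ^ 2 / (2 * γ))
    have hdiv : (2 * γ)⁻¹ * (a ^ 2 * ‖v - g‖ ^ 2) = a ^ 2 / (2 * γ) * ‖v - g‖ ^ 2 := by ring
    linarith
  rw [inner_sub_left] at hnoise
  linear_combination hrle + a * hFle + b * hinertia + hnoise + ‖D‖ ^ 2 * hγ2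

theorem norm_step_sub_le (hr : ClosedConvex r) (ha : 0 < a) {x x' xₚ q g v : Vec n}
    (hstep : IsProx a r (x - a • g + b • (x - xₚ)) x') (hq : q ∈ effDom r)
    (hv : (r q).toReal + ρ' * inner ℝ (x - q) (x' - q) ≤
      (r x').toReal + inner ℝ v (x' - q)) :
    ‖x' - q‖ ≤ ‖(1 - a * ρ') • (x - q) + (a • (v - g) + b • (x - xₚ))‖ := by
  set W := (1 - a * ρ') • (x - q) + (a • (v - g) + b • (x - xₚ)) with hW
  have hrle := hstep.mul_toReal_add_inner_le hr ha hq
  have hresidual : x - a • g + b • (x - xₚ) - x'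
      = W + (a * ρ') • (x - q) - a • v - (x' - q) := by rw [hW]; module
  rw [hresidual, ← neg_sub x' q, inner_neg_right, inner_sub_left, inner_sub_left, inner_add_left,
    real_inner_smul_left, real_inner_smul_left, real_inner_self_eq_norm_sq] at hrle
  have hsq : ‖x' - q‖ ^ 2 ≤ inner ℝ W (x' - q) := by
    linear_combination hrle + a * hv
  nlinarith [hsq.trans (real_inner_le_norm W (x' - q)), norm_nonneg W, norm_nonneg (x' - q)]

theorem sq_norm_step_sub_prox_le (hF : WeaklyConvex ρ F) (hr : ClosedConvex r)
    (hG : ∀ x ∈ effDom r, G x ∈ subdiff F x) (hGM : ∀ x ∈ effDom r, ‖G x‖ ≤ M)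
    (hρ' : ρ < ρ') (ha : 0 < a) (haρ : a * ρ' ≤ 1) {x x' xₚ q g : Vec n} (hx : x ∈ effDom r)
    (hstep : IsProx a r (x - a • g + b • (x - xₚ)) x')
    (hq : IsProx (1 / ρ') (objective F r) x q) :
    ‖x' - q‖ ^ 2 ≤ (1 + a * (ρ' - ρ) / 2) * (1 - a * ρ') ^ 2 * ‖x - q‖ ^ 2
      + (2 + 2 / (a * (ρ' - ρ))) * (b ^ 2 * ‖x - xₚ‖ ^ 2)
      + 4 * a ^ 2 * (‖g‖ ^ 2 + M ^ 2)
      + 2 * a * (1 - a * ρ') * (F x - F q + ρ / 2 * ‖x - q‖ ^ 2 - inner ℝ (x - q) g) := by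
  have hdom := effDom_objective F r
  have hqr : q ∈ effDom r := hdom ▸ hq.mem_effDom (hdom.symm ▸ hx)
  obtain ⟨v, hvM, hvF, hvopt⟩ := exists_bounded_subgradient hF hr hG hGM hq (hstep.mem_effDom hx)
  rw [one_div_one_div] at hvopt
  have hε : 0 < a * (ρ' - ρ) / 2 := half_pos (mul_pos ha (sub_pos.2 hρ'))
  have hsq := (pow_le_pow_left₀ (norm_nonneg _)
    (norm_step_sub_le hr ha hstep hqr hvopt) 2).trans
    (norm_smul_add_add_sq_le hε (1 - a * ρ') (x - q) (a • (v - g)) (b • (x - xₚ)))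
  rw [inv_div, norm_smul, norm_smul, mul_pow, mul_pow, Real.norm_eq_abs, Real.norm_eq_abs, sq_abs,
    sq_abs, inner_smul_right, inner_sub_right, real_inner_comm v] at hsq
  have hvx : inner ℝ v (x - q) ≤ F x - F q + ρ / 2 * ‖x - q‖ ^ 2 := by linarith [hvF x]
  have hcoef : 0 ≤ 2 * a * (1 - a * ρ') := mul_nonneg (by positivity) (sub_nonneg.2 haρ)
  linear_combination hsq + 2 * a ^ 2 * norm_sub_sq_le_of_norm_le hvM g
    + mul_le_mul_of_nonneg_left hvx hcoef

/-- The error committed in one step by using a subgradient of `F` at a delayed iterate `y` in place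
of one at the current iterate `x`, as it enters the decrease of the Moreau envelope. -/
def delayError (F : Vec n → ℝ) (ρ ρ' M : ℝ) (x y : Vec n) : ℝ :=
  F x - F y + M * ‖x - y‖ + (ρ / 2 + ρ ^ 2 / (ρ' - ρ)) * ‖x - y‖ ^ 2

theorem abs_sub_le_of_mem_subdiff (hF : StrongConvexOn Set.univ (-ρ) F) {x y v w : Vec n}
    (hv : v ∈ subdiff F x) (hvM : ‖v‖ ≤ M) (hw : w ∈ subdiff F y) (hwM : ‖w‖ ≤ M) :
    |F y - F x| ≤ M * ‖y - x‖ + ρ / 2 * ‖y - x‖ ^ 2 := by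
  have hlower : ∀ {x y v : Vec n}, v ∈ subdiff F x → ‖v‖ ≤ M →
      F x - F y ≤ M * ‖y - x‖ + ρ / 2 * ‖y - x‖ ^ 2 := fun {x y v} hv hvM => by
    have hinner : -inner ℝ v (y - x) ≤ M * ‖y - x‖ :=
      (neg_le_abs _).trans ((abs_real_inner_le_norm v (y - x)).trans (by gcongr))
    linarith [le_of_mem_subdiff hF hv y]
  refine abs_sub_le_iff.2 ⟨?_, hlower hv hvM⟩
  simpa only [norm_sub_rev x y] using hlower (y := x) hw hwM

theorem sub_inner_delayed_subgradient_le (hF : StrongConvexOn Set.univ (-ρ) F) (hρ' : ρ < ρ')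
    {x q y v : Vec n} (hv : v ∈ subdiff F y) (hvM : ‖v‖ ≤ M) :
    F x - F q + ρ / 2 * ‖x - q‖ ^ 2 - inner ℝ (x - q) v ≤
      (ρ + (ρ' - ρ) / 4) * ‖x - q‖ ^ 2 + delayError F ρ ρ' M x y := by
  have hFle := le_of_mem_subdiff hF hv q
  rw [← sub_sub_sub_cancel_left y q x, norm_sub_sq_real, inner_sub_right] at hFle
  have hfar : -inner ℝ v (x - y) ≤ M * ‖x - y‖ :=
    (neg_le_abs _).trans ((abs_real_inner_le_norm v (x - y)).trans (by gcongr))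
  have hyoung := two_mul_inner_le (half_pos (sub_pos.2 hρ')) (x - q) (-ρ • (x - y))
  rw [inner_smul_right, norm_smul, mul_pow, Real.norm_eq_abs, sq_abs, inv_div] at hyoung
  rw [delayError, real_inner_comm]
  rw [real_inner_comm (x - y) (x - q)] at hyoung
  linear_combination hFle + hfar + hyoung / 2

theorem contraction_factor_le {s t : ℝ} (hs : 0 ≤ s) (hst : s ≤ t) (ht : t ≤ 1) :
    (1 + s / 2) * (1 - t) ^ 2 + 2 * (1 - t) * (t - s + s / 4) ≤ 1 - s := by
  have hgap : 0 ≤ t * (t - s / 2 - t * s / 2) := mul_nonneg (hs.trans hst) (by nlinarith)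
  linear_combination hgap

/-- The error of one step from `x`, with previous iterate `xₚ`, delayed iterate `y` and sample
subgradient `g`, in the decrease of the Moreau envelope, up to the factor `ρ' / 2` and the noise of
`g`: the contributions of the inertia, of the step length and of the delay. -/
def stepError (F : Vec n → ℝ) (ρ ρ' M a b : ℝ) (x xₚ y g : Vec n) : ℝ :=
  (2 + 2 / (a * (ρ' - ρ))) * (b ^ 2 * ‖x - xₚ‖ ^ 2) + 4 * a ^ 2 * (‖g‖ ^ 2 + M ^ 2)
    + 2 * a * (1 - a * ρ') * delayError F ρ ρ' M x y

theorem moreauEnvelope_step_le (hF : WeaklyConvex ρ F) (hr : ClosedConvex r)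
    (hG : ∀ x ∈ effDom r, G x ∈ subdiff F x) (hGM : ∀ x ∈ effDom r, ‖G x‖ ≤ M)
    (hρ' : ρ < ρ') (ha : 0 < a) (haρ : a * ρ' ≤ 1) {x x' xₚ q q' y g : Vec n}
    (hx : x ∈ effDom r) (hy : y ∈ effDom r)
    (hstep : IsProx a r (x - a • g + b • (x - xₚ)) x')
    (hq : IsProx (1 / ρ') (objective F r) x q) (hq' : IsProx (1 / ρ') (objective F r) x' q') :
    moreauEnvelope (1 / ρ') (objective F r) x' + ρ' / 2 * (a * (ρ' - ρ)) * ‖x - q‖ ^ 2 ≤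
      moreauEnvelope (1 / ρ') (objective F r) x
        + ρ' / 2 * (stepError F ρ ρ' M a b x xₚ y g
          + 2 * a * (1 - a * ρ') * inner ℝ (x - q) (G y - g)) := by
  have hbot := objective_ne_bot F hr.ne_bot
  have hxφ : x ∈ effDom (objective F r) := (effDom_objective F r).symm ▸ hx
  have henv := hq'.moreauEnvelope_le hbot (hq.mem_effDom hxφ)
  have hhalf : 1 / (2 * (1 / ρ')) = ρ' / 2 := by rw [mul_one_div, one_div_div]
  rw [hhalf, norm_sub_rev q x'] at henv
  rw [hq.moreauEnvelope_eq hbot hxφ, hhalf, norm_sub_rev q x, inner_sub_right, stepError]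
  have hdist := sq_norm_step_sub_prox_le hF hr hG hGM hρ' ha haρ hx hstep hq
  have hdelay := sub_inner_delayed_subgradient_le hF.strongConvexOn hρ' (x := x) (q := q)
    (hG y hy) (hGM y hy)
  have hcontract := contraction_factor_le (s := a * (ρ' - ρ)) (t := a * ρ')
    (mul_nonneg ha.le (sub_nonneg.2 hρ'.le)) (by nlinarith [hF.1]) haρ
  have hcoef : 0 ≤ 2 * a * (1 - a * ρ') := mul_nonneg (by positivity) (sub_nonneg.2 haρ)
  have hρ'_half : 0 ≤ ρ' / 2 := by linarith [hF.1]
  linear_combination henv + mul_le_mul_of_nonneg_left hdist hρ'_half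
    + mul_le_mul_of_nonneg_left (mul_le_mul_of_nonneg_left hdelay hcoef) hρ'_half
    + mul_le_mul_of_nonneg_left (mul_le_mul_of_nonneg_right hcontract (sq_nonneg ‖x - q‖)) hρ'_half

end Step

/-! ### Independence and second moments -/

section Independence

variable {Ω α β γ : Type*} {mΩ : MeasurableSpace Ω} {mα : MeasurableSpace α}
  {mβ : MeasurableSpace β} {mγ : MeasurableSpace γ} {P : Measure Ω} [IsProbabilityMeasure P]

theorem indepFun_prodMk_left_of_prodMk_right {X : Ω → α} {Y : Ω → β} {Z : Ω → γ}
    (hX : Measurable X) (hY : Measurable Y) (hZ : Measurable Z)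
    (hXYZ : IndepFun X (fun ω => (Y ω, Z ω)) P) (hYZ : IndepFun Y Z P) :
    IndepFun (fun ω => (X ω, Z ω)) Y P := by
  have hXZ : IndepFun X Z P := hXYZ.comp measurable_id measurable_snd
  have := Measure.isProbabilityMeasure_map (μ := P) hX.aemeasurable
  have := Measure.isProbabilityMeasure_map (μ := P) hY.aemeasurable
  have := Measure.isProbabilityMeasure_map (μ := P) hZ.aemeasurable
  rw [indepFun_iff_map_prod_eq_prod_map_map (hX.prodMk hZ).aemeasurable hY.aemeasurable,
    hXZ.map_prod_eq_prod_map_map hX.aemeasurable hZ.aemeasurable]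
  have hjoint : P.map (fun ω => (X ω, Y ω, Z ω)) = (P.map X).prod ((P.map Y).prod (P.map Z)) := by
    rw [hXYZ.map_prod_eq_prod_map_map hX.aemeasurable (hY.prodMk hZ).aemeasurable,
      hYZ.map_prod_eq_prod_map_map hY.aemeasurable hZ.aemeasurable]
  have hswap := (measurePreserving_prodAssoc (P.map X) (P.map Z) (P.map Y)).symm.comp
    ((MeasurePreserving.id (P.map X)).prod
      (Measure.measurePreserving_swap (μ := P.map Y) (ν := P.map Z)))
  rw [← hswap.map_eq, ← hjoint, Measure.map_map hswap.measurable (hX.prodMk (hY.prodMk hZ))]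
  rfl

variable {Y : Ω → α} {ζ : Ω → β}

theorem lintegral_comp_of_indepFun {f : α → β → ENNReal} (hf : Measurable (Function.uncurry f))
    (hY : Measurable Y) (hζ : Measurable ζ) (hYζ : IndepFun Y ζ P) :
    ∫⁻ ω, f (Y ω) (ζ ω) ∂P = ∫⁻ ω, ∫⁻ e, f (Y ω) e ∂(P.map ζ) ∂P :=
  calc ∫⁻ ω, f (Y ω) (ζ ω) ∂P
      = ∫⁻ q, f q.1 q.2 ∂(P.map fun ω => (Y ω, ζ ω)) := (lintegral_map hf (hY.prodMk hζ)).symm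
    _ = ∫⁻ y, ∫⁻ e, f y e ∂(P.map ζ) ∂(P.map Y) := by
        rw [hYζ.map_prod_eq_prod_map_map hY.aemeasurable hζ.aemeasurable]
        exact lintegral_prod _ hf.aemeasurable
    _ = ∫⁻ ω, ∫⁻ e, f (Y ω) e ∂(P.map ζ) ∂P := lintegral_map hf.lintegral_prod_right' hY

theorem integral_comp_of_indepFun {E : Type*} [NormedAddCommGroup E] [NormedSpace ℝ E]
    {f : α → β → E} (hf : StronglyMeasurable (Function.uncurry f)) (hY : Measurable Y)
    (hζ : Measurable ζ) (hYζ : IndepFun Y ζ P) (hint : Integrable (fun ω => f (Y ω) (ζ ω)) P) :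
    ∫ ω, f (Y ω) (ζ ω) ∂P = ∫ ω, ∫ e, f (Y ω) e ∂(P.map ζ) ∂P := by
  have hprod := hYζ.map_prod_eq_prod_map_map hY.aemeasurable hζ.aemeasurable
  have hint' : Integrable (Function.uncurry f) ((P.map Y).prod (P.map ζ)) := by
    rw [← hprod]
    exact (integrable_map_measure hf.aestronglyMeasurable (hY.prodMk hζ).aemeasurable).2 hint
  calc ∫ ω, f (Y ω) (ζ ω) ∂P
      = ∫ q, Function.uncurry f q ∂(P.map fun ω => (Y ω, ζ ω)) :=
        (integral_map (hY.prodMk hζ).aemeasurable hf.aestronglyMeasurable).symm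
    _ = ∫ y, ∫ e, f y e ∂(P.map ζ) ∂(P.map Y) := by rw [hprod]; exact integral_prod _ hint'
    _ = ∫ ω, ∫ e, f (Y ω) e ∂(P.map ζ) ∂P :=
        integral_map hY.aemeasurable hf.integral_prod_right'.aestronglyMeasurable

end Independence

section Moments

variable {Ω E F : Type*} [MeasurableSpace Ω] {P : Measure Ω} [NormedAddCommGroup E]
  [NormedAddCommGroup F]

theorem memLp_two_of_lintegral_le {s : Ω → E} (hs : AEStronglyMeasurable s P) {C : ℝ}
    (hC : ∫⁻ ω, ‖s ω‖ₑ ^ 2 ∂P ≤ ENNReal.ofReal C) : MemLp s 2 P := by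
  refine (memLp_two_iff_integrable_sq_norm hs).2 ⟨hs.norm.pow 2, ?_⟩
  simp only [HasFiniteIntegral, enorm_pow, enorm_norm]
  exact hC.trans_lt ENNReal.ofReal_lt_top

theorem integral_sq_norm_le_of_lintegral_le {s : Ω → E} (hs : AEStronglyMeasurable s P) {C : ℝ}
    (hC₀ : 0 ≤ C) (hC : ∫⁻ ω, ‖s ω‖ₑ ^ 2 ∂P ≤ ENNReal.ofReal C) : ∫ ω, ‖s ω‖ ^ 2 ∂P ≤ C := by
  have hnorm : ∫ ω, ‖s ω‖ ^ 2 ∂P = ∫ ω, ‖‖s ω‖ ^ 2‖ ∂P := by simp only [norm_pow, norm_norm]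
  rw [hnorm, integral_norm_eq_lintegral_enorm (f := fun ω => ‖s ω‖ ^ 2) (hs.norm.pow 2)]
  simp only [enorm_pow, enorm_norm]
  exact ENNReal.toReal_le_of_le_ofReal hC₀ hC

theorem sq_integral_le_integral_sq [IsProbabilityMeasure P] {X : Ω → ℝ} (hX : MemLp X 2 P) :
    (∫ ω, X ω ∂P) ^ 2 ≤ ∫ ω, X ω ^ 2 ∂P :=
  sub_nonneg.1 (variance_eq_sub hX ▸ variance_nonneg X P)

theorem norm_integral_le_of_integral_sq_le [NormedSpace ℝ E] [IsProbabilityMeasure P] {s : Ω → E}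
    (hs : MemLp s 2 P) {M : ℝ} (hM : 0 ≤ M) (hsM : ∫ ω, ‖s ω‖ ^ 2 ∂P ≤ M ^ 2) :
    ‖∫ ω, s ω ∂P‖ ≤ M :=
  (norm_integral_le_integral_norm s).trans
    (le_of_abs_le (abs_le_of_sq_le_sq ((sq_integral_le_integral_sq hs.norm).trans hsM) hM))

theorem integrable_inner_of_memLp_two {V : Type*} [NormedAddCommGroup V] [InnerProductSpace ℝ V]
    {s t : Ω → V} (hs : MemLp s 2 P) (ht : MemLp t 2 P) :
    Integrable (fun ω => inner ℝ (s ω) (t ω)) P :=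
  memLp_one_iff_integrable.1 ((innerSL ℝ).memLp_of_bilin 1 hs ht)

theorem memLp_lipschitz_comp [IsFiniteMeasure P] {p : ENNReal} {L : NNReal} {φ : E → F}
    (hφ : LipschitzWith L φ) {z : Ω → E} (hz : MemLp z p P) : MemLp (fun ω => φ (z ω)) p P := by
  have hcentered : LipschitzWith L fun v => φ v - φ 0 :=
    LipschitzWith.of_dist_le_mul fun u v => (dist_sub_right _ _ _).trans_le (hφ.dist_le_mul u v)
  simpa only [Function.comp_def, Pi.add_def, sub_add_cancel] using
    (hcentered.comp_memLp (sub_self _) hz).add (memLp_const (φ 0))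

end Moments

section RandomIndex

variable {Ω ι : Type*} [MeasurableSpace ι]

theorem measurable_comp_random_index [MeasurableSingletonClass ι] [Countable ι] {β : Type*}
    [MeasurableSpace β] {_ : MeasurableSpace Ω} {Ψ : ι → Ω → β} (hΨ : ∀ j, Measurable (Ψ j))
    {N : Ω → ι} (hN : Measurable N) : Measurable fun ω => Ψ (N ω) ω :=
  (measurable_from_prod_countable_left (f := fun q : Ω × ι => Ψ q.2 q.1) hΨ).comp
    (measurable_id.prodMk hN)

variable [MeasurableSingletonClass ι] [MeasurableSpace Ω] {P : Measure Ω} {N : Ω → ι}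
  {S : Finset ι} {Φ : ι → Ω → ℝ}

theorem integral_indicator_eq_mul_of_indepFun (hN : Measurable N) {X : Ω → ℝ}
    (hX : AEStronglyMeasurable X P) (hNX : IndepFun N X P) (j : ι) :
    ∫ ω, {ω | N ω = j}.indicator X ω ∂P = P.real {ω | N ω = j} * ∫ ω, X ω ∂P := by
  have hmeas : MeasurableSet {ω | N ω = j} := hN (measurableSet_singleton j)
  have hone : Measurable (({j} : Set ι).indicator (1 : ι → ℝ)) :=
    measurable_one.indicator (measurableSet_singleton j)
  calc ∫ ω, {ω | N ω = j}.indicator X ω ∂P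
      = ∫ ω, ({j} : Set ι).indicator (1 : ι → ℝ) (N ω) * X ω ∂P := by
        congr with ω
        by_cases hω : N ω = j <;> simp [hω]
    _ = (∫ ω, ({j} : Set ι).indicator (1 : ι → ℝ) (N ω) ∂P) * ∫ ω, X ω ∂P :=
        (hNX.comp hone measurable_id).integral_fun_mul_eq_mul_integral
          (hone.comp hN).aestronglyMeasurable hX
    _ = P.real {ω | N ω = j} * ∫ ω, X ω ∂P := by
        rw [← integral_indicator_one hmeas]
        rfl

variable [IsProbabilityMeasure P]

theorem ae_mem_of_sum_measureReal_eq_one (hN : Measurable N)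
    (hS : ∑ j ∈ S, P.real {ω | N ω = j} = 1) : ∀ᵐ ω ∂P, N ω ∈ S := by
  have hdisj : (S : Set ι).PairwiseDisjoint fun j => {ω | N ω = j} := fun i _ j _ hij =>
    Set.disjoint_left.2 fun ω (hi : N ω = i) (hj : N ω = j) => hij (hi.symm.trans hj)
  have hunion : ⋃ j ∈ S, {ω | N ω = j} = {ω | N ω ∈ S} := by ext ω; simp
  have hone : P.real {ω | N ω ∈ S} = 1 := by
    rw [← hunion, measureReal_biUnion_finset hdisj fun j _ => hN (measurableSet_singleton j), hS]
  have hmeas : MeasurableSet {ω | N ω ∈ S} := hN S.measurableSet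
  refine (prob_compl_eq_zero_iff hmeas).2 ?_
  rw [← ofReal_measureReal (μ := P), hone, ENNReal.ofReal_one]

theorem comp_random_index_ae_eq_sum_indicator (hN : Measurable N)
    (hS : ∑ j ∈ S, P.real {ω | N ω = j} = 1) :
    (fun ω => Φ (N ω) ω) =ᵐ[P] fun ω => ∑ j ∈ S, {ω | N ω = j}.indicator (Φ j) ω := by
  classical
  filter_upwards [ae_mem_of_sum_measureReal_eq_one hN hS] with ω hω
  simp [Set.indicator_apply, hω]

theorem integrable_comp_random_index (hN : Measurable N)
    (hS : ∑ j ∈ S, P.real {ω | N ω = j} = 1) (hint : ∀ j ∈ S, Integrable (Φ j) P) :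
    Integrable (fun ω => Φ (N ω) ω) P :=
  (integrable_finsetSum S fun j hj =>
    (hint j hj).indicator (hN (measurableSet_singleton j))).congr
    (comp_random_index_ae_eq_sum_indicator hN hS).symm

theorem integral_comp_random_index (hN : Measurable N)
    (hS : ∑ j ∈ S, P.real {ω | N ω = j} = 1) (hint : ∀ j ∈ S, Integrable (Φ j) P)
    (hind : ∀ j ∈ S, IndepFun N (Φ j) P) :
    ∫ ω, Φ (N ω) ω ∂P = ∑ j ∈ S, P.real {ω | N ω = j} * ∫ ω, Φ j ω ∂P := by
  have hmeas : ∀ j, MeasurableSet {ω | N ω = j} := fun j => hN (measurableSet_singleton j)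
  rw [integral_congr_ae (comp_random_index_ae_eq_sum_indicator hN hS),
    integral_finsetSum S fun j hj => (hint j hj).indicator (hmeas j)]
  exact Finset.sum_congr rfl fun j hj =>
    integral_indicator_eq_mul_of_indepFun hN (hint j hj).aestronglyMeasurable (hind j hj) j

end RandomIndex

/-! ### The randomness of the iterates -/

section Sampling

variable {Ω Ξ : Type*} [MeasurableSpace Ξ] {K k : ℕ} {ξ : ℕ → Ω → Ξ} {d : ℕ → Ω → ℕ}

/-- The σ-algebra of the information available before step `k`, generated by the samples and
delays of the steps `1, …, k - 1` (among the `K` steps of the method). -/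
@[reducible]
def pastSigma (ξ : ℕ → Ω → Ξ) (d : ℕ → Ω → ℕ) (K k : ℕ) : MeasurableSpace Ω :=
  ⨆ i ∈ {i : Set.Icc 1 K | i.1 < k},
    MeasurableSpace.comap (fun ω => (ξ i.1 ω, d i.1 ω)) inferInstance

theorem measurable_pair_pastSigma {i : ℕ} (hi : i ∈ Set.Icc 1 K) (hik : i < k) :
    Measurable[pastSigma ξ d K k] fun ω => (ξ i ω, d i ω) := by
  rw [measurable_iff_comap_le]
  exact le_biSup (f := fun i : Set.Icc 1 K =>
    MeasurableSpace.comap (fun ω => (ξ i.1 ω, d i.1 ω)) inferInstance) (i := ⟨i, hi⟩) hik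

variable [mΩ : MeasurableSpace Ω] {P : Measure Ω} {μ : Measure Ξ} {τ : ℕ} {p : ℕ → ℝ}

theorem IsSampling.measurable_pair (h : IsSampling P μ τ p K ξ d) (i : Set.Icc 1 K) :
    Measurable fun ω => (ξ i.1 ω, d i.1 ω) :=
  (h.measurable_sample i i.2).prodMk (h.measurable_delay i i.2)

theorem IsSampling.pastSigma_le (h : IsSampling P μ τ p K ξ d) (k : ℕ) :
    pastSigma ξ d K k ≤ mΩ :=
  iSup₂_le fun i _ => (h.measurable_pair i).comap_le

theorem IsSampling.sum_measureReal_delay (h : IsSampling P μ τ p K ξ d) (hk : k ∈ Set.Icc 1 K) :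
    ∑ j ∈ Finset.range (τ + 1), P.real {ω | d k ω = j} = 1 := by
  rw [← h.sum_law_delay]
  exact Finset.sum_congr rfl fun j hj => h.law_delay k hk j (Finset.mem_range_succ_iff.1 hj)

theorem IsSampling.indep_pastSigma (h : IsSampling P μ τ p K ξ d) (hk : k ∈ Set.Icc 1 K) :
    Indep (pastSigma ξ d K k)
      (MeasurableSpace.comap (fun ω => (ξ k ω, d k ω)) inferInstance) P := by
  have hdisj : Disjoint {i : Set.Icc 1 K | i.1 < k} {⟨k, hk⟩} :=
    Set.disjoint_singleton_right.2 (lt_irrefl k)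
  simpa [pastSigma] using indep_iSup_of_disjoint (fun i => (h.measurable_pair i).comap_le)
    h.indep_steps hdisj

theorem IsRandomIndex.indepFun_of_measurable_pastSigma {a : ℕ → ℝ} {T : Ω → ℕ}
    (h : IsRandomIndex P a K ξ d T) {β : Type*} [MeasurableSpace β] {U : Ω → β}
    (hU : Measurable[pastSigma ξ d K k] U) : IndepFun T U P := by
  let history : Ω → Set.Icc 1 K → Ξ × ℕ := fun ω i => (ξ i ω, d i ω)
  have hpast : pastSigma ξ d K k ≤ MeasurableSpace.comap history inferInstance :=
    iSup₂_le fun i _ => ((measurable_pi_apply i).comp (comap_measurable history)).comap_le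
  exact (IndepFun_iff_Indep _ _ _).2 (indep_of_indep_of_le_right
    ((IndepFun_iff_Indep _ _ _).1 h.indep) (hU.comap_le.trans hpast))

variable [IsProbabilityMeasure P]

theorem IsSampling.ae_delay_le (h : IsSampling P μ τ p K ξ d) (hk : k ∈ Set.Icc 1 K) :
    ∀ᵐ ω ∂P, d k ω ≤ τ := by
  filter_upwards [ae_mem_of_sum_measureReal_eq_one (h.measurable_delay k hk)
    (h.sum_measureReal_delay hk)] with ω hω
  exact Finset.mem_range_succ_iff.1 hω

-- The past is represented by the identity map from `Ω` to `Ω` equipped with `pastSigma`.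
theorem IsSampling.indepFun_delayed (h : IsSampling P μ τ p K ξ d) (hk : k ∈ Set.Icc 1 K)
    {β : Type*} [MeasurableSpace β] {Φ : ℕ → Ω → β}
    (hΦ : ∀ j, Measurable[pastSigma ξ d K k] (Φ j)) :
    IndepFun (fun ω => Φ (d k ω) ω) (ξ k) P := by
  have hpast : @IndepFun Ω Ω (Ξ × ℕ) mΩ (pastSigma ξ d K k) _ id (fun ω => (ξ k ω, d k ω)) P :=
    (@IndepFun_iff_Indep Ω Ω (Ξ × ℕ) mΩ (pastSigma ξ d K k) _ _ _ P).2
      (by simpa only [MeasurableSpace.comap_id] using h.indep_pastSigma hk)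
  have hpast_delay := @indepFun_prodMk_left_of_prodMk_right Ω Ω Ξ ℕ mΩ (pastSigma ξ d K k) _ _ P _
    id (ξ k) (d k) (measurable_id'' (h.pastSigma_le k)) (h.measurable_sample k hk)
    (h.measurable_delay k hk) hpast (h.indep_sample_delay k hk)
  have hΦ' : @Measurable (Ω × ℕ) β (@Prod.instMeasurableSpace Ω ℕ (pastSigma ξ d K k) _) _
      fun q => Φ q.2 q.1 :=
    @measurable_from_prod_countable_left Ω ℕ β (pastSigma ξ d K k) _ _ _ _ _ hΦ
  exact hpast_delay.comp hΦ' measurable_id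

end Sampling

section Iterates

variable {n : ℕ}

theorem exists_lipschitz_proxMap {h : Vec n → EReal} {c ρ m : ℝ} {w : Vec n}
    (hlsc : LowerSemicontinuous h) (hm : ∀ x, (m : EReal) ≤ h x) (hw : w ∈ effDom h)
    (hconv : StrongConvexOn (effDom h) (-ρ) fun x => (h x).toReal) (hc : 0 < c)
    (hcρ : ρ < 1 / c) :
    ∃ (L : NNReal) (pr : Vec n → Vec n), LipschitzWith L pr ∧ (∀ z, IsProx c h z (pr z)) ∧
      ∀ z y, IsProx c h z y → y = pr z := by
  have hbot : ∀ x, h x ≠ ⊥ := fun x => ne_bot_of_le_ne_bot (EReal.coe_ne_bot m) (hm x)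
  choose pr hpr using exists_isProx hlsc hm hw hc
  have hL : 0 ≤ 1 / c / (1 / c - ρ) := div_nonneg (by positivity) (by linarith)
  refine ⟨⟨1 / c / (1 / c - ρ), hL⟩, pr, LipschitzWith.of_dist_le_mul fun z z' => ?_, hpr,
    fun z y hy => ?_⟩
  · rw [dist_eq_norm, dist_eq_norm]
    exact (hpr z).norm_sub_le hbot hconv hw hc hcρ (hpr z')
  · have hle := hy.norm_sub_le hbot hconv hw hc hcρ (hpr z)
    rw [sub_self, norm_zero, mul_zero] at hle
    exact sub_eq_zero.1 (norm_le_zero_iff.1 hle)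

variable {Ω Ξ : Type*} {r : Vec n → EReal} {g : ℕ → Vec n → Ξ → Vec n}
  {a b : ℕ → ℝ} {ξ : ℕ → Ω → Ξ} {d : ℕ → Ω → ℕ} {K k : ℕ} {x₀ : Vec n} {x : ℕ → Ω → Vec n}

theorem IsIterateSequence.induction (hx : IsIterateSequence r g a b ξ d K x₀ x)
    {motive : ℕ → (Ω → Vec n) → Prop} (start : ∀ k, motive k fun _ => x₀)
    (step : ∀ k ∈ Set.Icc 1 K, (∀ j ≤ k, motive j (x j)) → motive (k + 1) (x (k + 1)))
    (hk : k ≤ K + 1) : motive k (x k) := by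
  induction k using Nat.strong_induction_on with
  | _ k ih =>
    match k with
    | 0 => exact funext hx.zero ▸ start 0
    | 1 => exact funext hx.one ▸ start 1
    | k + 2 => exact step (k + 1) ⟨by omega, by omega⟩ fun j hj => ih j (by omega) (by omega)

theorem IsIterateSequence.mem_effDom (hx : IsIterateSequence r g a b ξ d K x₀ x)
    (hk : k ≤ K + 1) (ω : Ω) : x k ω ∈ effDom r :=
  hx.induction (motive := fun _ y => y ω ∈ effDom r) (fun _ => hx.start_mem)
    (fun k hk _ => (hx.step k hk ω).mem_effDom hx.start_mem) hk

theorem IsIterateSequence.measurable_pastSigma [MeasurableSpace Ξ]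
    (hx : IsIterateSequence r g a b ξ d K x₀ x)
    (hg : ∀ k ∈ Set.Icc 1 K, Measurable (Function.uncurry (g k)))
    (hpr : ∀ k ∈ Set.Icc 1 K, ∃ pr : Vec n → Vec n, Continuous pr ∧
      ∀ z y, IsProx (a k) r z y → y = pr z) {l : ℕ} (hk : k ≤ K + 1) (hl : k ≤ l) :
    Measurable[pastSigma ξ d K l] (x k) := by
  let _ := pastSigma ξ d K l
  refine hx.induction (motive := fun k y => k ≤ l → Measurable y)
    (fun _ _ => measurable_const) (fun k hk ih hl => ?_) hk hl
  obtain ⟨pr, hcont, huniq⟩ := hpr k hk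
  have hpair := measurable_pair_pastSigma (ξ := ξ) (d := d) hk hl
  have hpast : ∀ j ≤ k, Measurable (x j) := fun j hj => ih j hj (by omega)
  have hdelayed : Measurable fun ω => x (k - d k ω) ω :=
    measurable_comp_random_index (Ψ := fun j => x (k - j)) (fun j => hpast _ (Nat.sub_le k j))
      (measurable_snd.comp hpair)
  have hsubgrad : Measurable fun ω => g k (x (k - d k ω) ω) (ξ k ω) :=
    (hg k hk).comp (hdelayed.prodMk (measurable_fst.comp hpair))
  rw [funext fun ω => huniq _ _ (hx.step k hk ω)]
  exact hcont.measurable.comp (((hpast k le_rfl).sub (hsubgrad.const_smul (a k))).add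
    (((hpast k le_rfl).sub (hpast (k - 1) (Nat.sub_le _ _))).const_smul (b k)))

theorem IsIterateSequence.memLp [MeasurableSpace Ω] {P : Measure Ω} [IsFiniteMeasure P]
    {p : ENNReal} (hx : IsIterateSequence r g a b ξ d K x₀ x)
    (hpr : ∀ k ∈ Set.Icc 1 K, ∃ (L : NNReal) (pr : Vec n → Vec n), LipschitzWith L pr ∧
      ∀ z y, IsProx (a k) r z y → y = pr z)
    (hg : ∀ k ∈ Set.Icc 1 K, MemLp (fun ω => g k (x (k - d k ω) ω) (ξ k ω)) p P)
    (hk : k ≤ K + 1) : MemLp (x k) p P := by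
  refine hx.induction (motive := fun _ y => MemLp y p P) (fun _ => memLp_const x₀)
    (fun k hk ih => ?_) hk
  obtain ⟨L, pr, hlip, huniq⟩ := hpr k hk
  rw [funext fun ω => huniq _ _ (hx.step k hk ω)]
  exact memLp_lipschitz_comp hlip (((ih k le_rfl).sub ((hg k hk).const_smul (a k))).add
    (((ih k le_rfl).sub (ih (k - 1) (Nat.sub_le _ _))).const_smul (b k)))

end Iterates

section DelayedSums

theorem sum_Icc_sub_one_add (f : ℕ → ℝ) (K : ℕ) :
    ∑ k ∈ Finset.Icc 1 K, f (k - 1) + f K = ∑ k ∈ Finset.Icc 1 K, f k + f 0 := by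
  induction K with
  | zero => simp
  | succ K ih =>
    rw [Finset.sum_Icc_succ_top (by omega), Finset.sum_Icc_succ_top (by omega),
      Nat.add_sub_cancel]
    linarith

theorem sum_Icc_sub_succ_add (f : ℕ → ℝ) (K i : ℕ) :
    ∑ k ∈ Finset.Icc 1 K, f (k - (i + 1)) + f (K - i) =
      ∑ k ∈ Finset.Icc 1 K, f (k - i) + f 0 := by
  simpa only [Nat.sub_sub, add_comm 1 i, Nat.zero_sub] using
    sum_Icc_sub_one_add (fun k => f (k - i)) K

theorem sum_Icc_delayed_le {f : ℕ → ℝ} (hf : ∀ k, 0 ≤ f k) (hf0 : f 0 = 0) (K i : ℕ) :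
    ∑ k ∈ Finset.Icc 1 K, f (k - i) ≤ ∑ k ∈ Finset.Icc 1 K, f k := by
  induction i with
  | zero => simp
  | succ i ih => linarith [sum_Icc_sub_succ_add f K i, hf (K - i)]

theorem sum_Icc_sub_delayed_le {f : ℕ → ℝ} {C : ℝ} {K : ℕ} (hf : ∀ k ≤ K, f k ≤ C) (j : ℕ) :
    ∑ k ∈ Finset.Icc 1 K, (f k - f (k - j)) ≤ j * (C - f 0) := by
  induction j with
  | zero => simp
  | succ j ih =>
    rw [Finset.sum_sub_distrib] at ih ⊢
    push_cast
    linarith [sum_Icc_sub_succ_add f K j, hf (K - j) (Nat.sub_le K j)]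

theorem sum_Icc_sqrt_le {f : ℕ → ℝ} {B : ℝ} {K : ℕ} (hf : ∀ k, 0 ≤ f k)
    (hB : ∑ k ∈ Finset.Icc 1 K, f k ≤ B) : ∑ k ∈ Finset.Icc 1 K, √(f k) ≤ √K * √B := by
  rw [← Real.sqrt_mul (Nat.cast_nonneg K)]
  refine Real.le_sqrt_of_sq_le (sq_sum_le_card_mul_sum_sq.trans ?_)
  simp only [Nat.card_Icc, Nat.add_sub_cancel, Real.sq_sqrt (hf _)]
  gcongr

theorem norm_sub_delayed_le {V : Type*} [NormedAddCommGroup V] (y : ℕ → V) (k : ℕ) {j τ : ℕ}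
    (hj : j ≤ τ) : ‖y k - y (k - j)‖ ≤ ∑ i ∈ Finset.range τ, ‖y (k - i) - y (k - i - 1)‖ := by
  induction τ, hj using Nat.le_induction with
  | base =>
    simpa only [dist_eq_norm, Nat.sub_zero, Nat.sub_sub] using
      dist_le_range_sum_dist (fun i => y (k - i)) j
  | succ τ _ ih =>
    rw [Finset.sum_range_succ]
    exact le_add_of_le_of_nonneg ih (norm_nonneg _)

theorem sq_norm_sub_delayed_le {V : Type*} [NormedAddCommGroup V] (y : ℕ → V) (k : ℕ) {j τ : ℕ}
    (hj : j ≤ τ) :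
    ‖y k - y (k - j)‖ ^ 2 ≤ τ * ∑ i ∈ Finset.range τ, ‖y (k - i) - y (k - i - 1)‖ ^ 2 :=
  calc ‖y k - y (k - j)‖ ^ 2
      ≤ (∑ i ∈ Finset.range τ, ‖y (k - i) - y (k - i - 1)‖) ^ 2 :=
        pow_le_pow_left₀ (norm_nonneg _) (norm_sub_delayed_le y k hj) 2
    _ ≤ τ * ∑ i ∈ Finset.range τ, ‖y (k - i) - y (k - i - 1)‖ ^ 2 := by
        simpa only [Finset.card_range] using sq_sum_le_card_mul_sum_sq (s := Finset.range τ)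
          (f := fun i => ‖y (k - i) - y (k - i - 1)‖)

theorem add_sum_le_add_sum_of_step_le {K : ℕ} {pot s m : ℕ → ℝ}
    (hstep : ∀ k ∈ Finset.Icc 1 K, pot (k + 1) + s k ≤ pot k + m k) :
    pot (K + 1) + ∑ k ∈ Finset.Icc 1 K, s k ≤ pot 1 + ∑ k ∈ Finset.Icc 1 K, m k := by
  have htele : ∑ k ∈ Finset.Icc 1 K, (pot (k + 1) - pot k) = pot (K + 1) - pot 1 := by
    rw [← Finset.Ico_add_one_right_eq_Icc, Finset.sum_Ico_sub _ (by omega)]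
  have hsum : ∑ k ∈ Finset.Icc 1 K, (pot (k + 1) - pot k) ≤ ∑ k ∈ Finset.Icc 1 K, (m k - s k) :=
    Finset.sum_le_sum fun k hk => by linarith [hstep k hk]
  rw [htele, Finset.sum_sub_distrib] at hsum
  linarith

theorem sum_integral_le_of_step_le {Ω : Type*} [MeasurableSpace Ω] {P : Measure Ω}
    [IsProbabilityMeasure P] {K : ℕ} {pot s m : ℕ → Ω → ℝ} {c c' : ℝ}
    (hs : ∀ k ∈ Finset.Icc 1 K, Integrable (s k) P)
    (hm : ∀ k ∈ Finset.Icc 1 K, Integrable (m k) P)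
    (hstep : ∀ k ∈ Finset.Icc 1 K, ∀ ω, pot (k + 1) ω + s k ω ≤ pot k ω + m k ω)
    (hfirst : ∀ ω, pot 1 ω = c) (hlast : ∀ ω, c' ≤ pot (K + 1) ω) :
    ∑ k ∈ Finset.Icc 1 K, ∫ ω, s k ω ∂P ≤ c - c' + ∑ k ∈ Finset.Icc 1 K, ∫ ω, m k ω ∂P := by
  have hpath : ∀ ω, ∑ k ∈ Finset.Icc 1 K, s k ω ≤ (c - c') + ∑ k ∈ Finset.Icc 1 K, m k ω :=
    fun ω => by
      linarith [add_sum_le_add_sum_of_step_le (pot := fun k => pot k ω) (s := fun k => s k ω)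
        (m := fun k => m k ω) fun k hk => hstep k hk ω, hfirst ω, hlast ω]
  have hmsum := integrable_finsetSum _ hm
  calc ∑ k ∈ Finset.Icc 1 K, ∫ ω, s k ω ∂P
      = ∫ ω, ∑ k ∈ Finset.Icc 1 K, s k ω ∂P := (integral_finsetSum _ hs).symm
    _ ≤ ∫ ω, ((c - c') + ∑ k ∈ Finset.Icc 1 K, m k ω) ∂P :=
        integral_mono (integrable_finsetSum _ hs) ((integrable_const _).add hmsum) hpath
    _ = c - c' + ∑ k ∈ Finset.Icc 1 K, ∫ ω, m k ω ∂P := by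
        rw [integral_add (integrable_const _) hmsum, integral_finsetSum _ hm, integral_const,
          probReal_univ, one_smul]

end DelayedSums

/-! ### Moments along a run -/

section Run

variable {n : ℕ} {Ξ Ω : Type*}

/-- The sample subgradient `g⁽ᵏ⁾` used in step `k`: the one picked by `g k` at the delayed iterate
for the fresh sample `ξ k`. -/
def sampleSubgradient (g : ℕ → Vec n → Ξ → Vec n) (ξ : ℕ → Ω → Ξ) (d : ℕ → Ω → ℕ)
    (x : ℕ → Ω → Vec n) (k : ℕ) (ω : Ω) : Vec n :=
  g k (x (k - d k ω) ω) (ξ k ω)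

/-- A run of `K` steps of the method with constant stepsize `a` and inertial parameter `b` on
`φ = F + r`, under the standing assumptions of the convergence theorem. The sample subgradients
are modelled by their first two moments: means in `∂F` and second moments at most `M ^ 2`. -/
structure IsInertialRun [MeasurableSpace Ξ] [MeasurableSpace Ω]
    (P : Measure Ω) (μ : Measure Ξ) (F : Vec n → ℝ) (r : Vec n → EReal) (ρ M C a b : ℝ)
    (g : ℕ → Vec n → Ξ → Vec n) (ξ : ℕ → Ω → Ξ) (d : ℕ → Ω → ℕ) (τ : ℕ) (p : ℕ → ℝ) (K : ℕ)
    (x₀ : Vec n) (x : ℕ → Ω → Vec n) : Prop where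
  weaklyConvex : WeaklyConvex ρ F
  closedConvex : ClosedConvex r
  optValue_ne_bot : optValue (objective F r) ≠ ⊥
  loss_le : ∀ y ∈ effDom r, F y ≤ C
  step_pos : 0 < a
  inertia_nonneg : 0 ≤ b
  bound_nonneg : 0 ≤ M
  oracle_measurable : ∀ k ∈ Set.Icc 1 K, Measurable (Function.uncurry (g k))
  oracle_lintegral_sq_le : ∀ k ∈ Set.Icc 1 K, ∀ y ∈ effDom r,
    ∫⁻ e, ‖g k y e‖ₑ ^ 2 ∂μ ≤ ENNReal.ofReal (M ^ 2)
  oracle_mean_mem : ∀ k ∈ Set.Icc 1 K, ∀ y ∈ effDom r, ∫ e, g k y e ∂μ ∈ subdiff F y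
  sampling : IsSampling P μ τ p K ξ d
  iterates : IsIterateSequence r g (fun _ => a) (fun _ => b) ξ d K x₀ x

end Run

namespace IsInertialRun

variable {n : ℕ} {Ξ Ω : Type*} [MeasurableSpace Ξ] [MeasurableSpace Ω]
  {P : Measure Ω} {μ : Measure Ξ} {F : Vec n → ℝ} {r : Vec n → EReal} {ρ M C a b : ℝ}
  {g : ℕ → Vec n → Ξ → Vec n} {ξ : ℕ → Ω → Ξ} {d : ℕ → Ω → ℕ} {τ : ℕ} {p : ℕ → ℝ} {K k : ℕ}
  {x₀ : Vec n} {x : ℕ → Ω → Vec n}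

theorem exists_lipschitz_prox (h : IsInertialRun P μ F r ρ M C a b g ξ d τ p K x₀ x) :
    ∃ (L : NNReal) (pr : Vec n → Vec n), LipschitzWith L pr ∧ ∀ z y, IsProx a r z y → y = pr z := by
  obtain ⟨L, pr, hlip, -, huniq⟩ := exists_lipschitz_proxMap (ρ := 0) h.closedConvex.lsc
    (toReal_optValue_sub_le h.closedConvex.ne_bot h.optValue_ne_bot h.loss_le)
    h.iterates.start_mem
    (by simpa only [neg_zero, strongConvexOn_zero] using h.closedConvex.convexOn_toReal)
    h.step_pos (one_div_pos.2 h.step_pos)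
  exact ⟨L, pr, hlip, huniq⟩

theorem start_mem_effDom_objective (h : IsInertialRun P μ F r ρ M C a b g ξ d τ p K x₀ x) :
    x₀ ∈ effDom (objective F r) :=
  (effDom_objective F r).symm ▸ h.iterates.start_mem

theorem exists_lipschitz_prox_objective (h : IsInertialRun P μ F r ρ M C a b g ξ d τ p K x₀ x)
    {ρ' : ℝ} (hρ' : ρ < ρ') : ∃ (L : NNReal) (pr : Vec n → Vec n),
      LipschitzWith L pr ∧ ∀ z, IsProx (1 / ρ') (objective F r) z (pr z) := by
  have hx₀ := h.start_mem_effDom_objective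
  have hm : ∀ y, ((optValue (objective F r)).toReal : EReal) ≤ objective F r y := fun y =>
    (coe_toReal_optValue h.optValue_ne_bot hx₀).trans_le (iInf_le _ y)
  obtain ⟨L, pr, hlip, hpr, -⟩ := exists_lipschitz_proxMap
    (lowerSemicontinuous_coe_add h.weaklyConvex.continuous h.closedConvex.lsc) hm hx₀
    (strongConvexOn_objective h.weaklyConvex.strongConvexOn h.closedConvex)
    (one_div_pos.2 (h.weaklyConvex.1.trans hρ')) (by rwa [one_div_one_div])
  exact ⟨L, pr, hlip, hpr⟩

theorem hasGradientAt_moreauEnvelope (h : IsInertialRun P μ F r ρ M C a b g ξ d τ p K x₀ x)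
    {ρ' : ℝ} (hρ' : ρ < ρ') {pr : Vec n → Vec n}
    (hpr : ∀ z, IsProx (1 / ρ') (objective F r) z (pr z)) (y : Vec n) :
    HasGradientAt (moreauEnvelope (1 / ρ') (objective F r)) (ρ' • (y - pr y)) y := by
  simpa only [one_div_one_div] using InertialSubgradient.hasGradientAt_moreauEnvelope
    (objective_ne_bot F h.closedConvex.ne_bot)
    (strongConvexOn_objective h.weaklyConvex.strongConvexOn h.closedConvex)
    h.start_mem_effDom_objective (one_div_pos.2 (h.weaklyConvex.1.trans hρ'))
    (by rwa [one_div_one_div]) hpr y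

theorem measurable_iterate_past (h : IsInertialRun P μ F r ρ M C a b g ξ d τ p K x₀ x)
    {l : ℕ} (hk : k ≤ K + 1) (hkl : k ≤ l) : Measurable[pastSigma ξ d K l] (x k) := by
  obtain ⟨L, pr, hlip, huniq⟩ := h.exists_lipschitz_prox
  exact h.iterates.measurable_pastSigma h.oracle_measurable
    (fun _ _ => ⟨pr, hlip.continuous, huniq⟩) hk hkl

theorem measurable_iterate (h : IsInertialRun P μ F r ρ M C a b g ξ d τ p K x₀ x)
    (hk : k ≤ K + 1) : Measurable (x k) :=
  (h.measurable_iterate_past hk le_rfl).mono (h.sampling.pastSigma_le k) le_rfl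

theorem measurable_delayed_iterate (h : IsInertialRun P μ F r ρ M C a b g ξ d τ p K x₀ x)
    (hk : k ∈ Set.Icc 1 K) : Measurable fun ω => x (k - d k ω) ω :=
  measurable_comp_random_index (Ψ := fun j => x (k - j))
    (fun j => h.measurable_iterate ((Nat.sub_le k j).trans (Nat.le_succ_of_le hk.2)))
    (h.sampling.measurable_delay k hk)

theorem delayed_iterate_mem_effDom (h : IsInertialRun P μ F r ρ M C a b g ξ d τ p K x₀ x)
    (hk : k ∈ Set.Icc 1 K) (ω : Ω) : x (k - d k ω) ω ∈ effDom r :=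
  h.iterates.mem_effDom ((Nat.sub_le k _).trans (Nat.le_succ_of_le hk.2)) ω

theorem measurable_sampleSubgradient (h : IsInertialRun P μ F r ρ M C a b g ξ d τ p K x₀ x)
    (hk : k ∈ Set.Icc 1 K) : Measurable (sampleSubgradient g ξ d x k) :=
  (h.oracle_measurable k hk).comp
    ((h.measurable_delayed_iterate hk).prodMk (h.sampling.measurable_sample k hk))

theorem memLp_oracle (h : IsInertialRun P μ F r ρ M C a b g ξ d τ p K x₀ x)
    (hk : k ∈ Set.Icc 1 K) {y : Vec n} (hy : y ∈ effDom r) : MemLp (g k y) 2 μ :=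
  memLp_two_of_lintegral_le
    ((h.oracle_measurable k hk).comp measurable_prodMk_left).aestronglyMeasurable
    (h.oracle_lintegral_sq_le k hk y hy)

theorem norm_oracle_mean_le [IsProbabilityMeasure μ]
    (h : IsInertialRun P μ F r ρ M C a b g ξ d τ p K x₀ x)
    (hk : k ∈ Set.Icc 1 K) {y : Vec n} (hy : y ∈ effDom r) : ‖∫ e, g k y e ∂μ‖ ≤ M :=
  norm_integral_le_of_integral_sq_le (h.memLp_oracle hk hy) h.bound_nonneg
    (integral_sq_norm_le_of_lintegral_le (h.memLp_oracle hk hy).1 (sq_nonneg M)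
      (h.oracle_lintegral_sq_le k hk y hy))

variable [IsProbabilityMeasure P]

theorem indepFun_iterate_delayed_iterate
    (h : IsInertialRun P μ F r ρ M C a b g ξ d τ p K x₀ x) (hk : k ∈ Set.Icc 1 K) :
    IndepFun (fun ω => (x k ω, x (k - d k ω) ω)) (ξ k) P := by
  have hk' : k ≤ K + 1 := Nat.le_succ_of_le hk.2
  exact h.sampling.indepFun_delayed hk (Φ := fun j ω => (x k ω, x (k - j) ω)) fun j =>
    (h.measurable_iterate_past hk' le_rfl).prodMk
      (h.measurable_iterate_past ((Nat.sub_le k j).trans hk') (Nat.sub_le k j))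

theorem lintegral_sq_sampleSubgradient_le
    (h : IsInertialRun P μ F r ρ M C a b g ξ d τ p K x₀ x) (hk : k ∈ Set.Icc 1 K) :
    ∫⁻ ω, ‖sampleSubgradient g ξ d x k ω‖ₑ ^ 2 ∂P ≤ ENNReal.ofReal (M ^ 2) := by
  have hfresh := lintegral_comp_of_indepFun (f := fun y e => ‖g k y e‖ₑ ^ 2)
    ((h.oracle_measurable k hk).enorm.pow_const 2) (h.measurable_delayed_iterate hk)
    (h.sampling.measurable_sample k hk)
    ((h.indepFun_iterate_delayed_iterate hk).comp measurable_snd measurable_id)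
  rw [h.sampling.law_sample k hk] at hfresh
  calc ∫⁻ ω, ‖sampleSubgradient g ξ d x k ω‖ₑ ^ 2 ∂P
      = ∫⁻ ω, ∫⁻ e, ‖g k (x (k - d k ω) ω) e‖ₑ ^ 2 ∂μ ∂P := hfresh
    _ ≤ ∫⁻ _, ENNReal.ofReal (M ^ 2) ∂P := lintegral_mono fun ω =>
        h.oracle_lintegral_sq_le k hk _ (h.delayed_iterate_mem_effDom hk ω)
    _ = ENNReal.ofReal (M ^ 2) := by rw [lintegral_const, measure_univ, mul_one]

theorem memLp_sampleSubgradient (h : IsInertialRun P μ F r ρ M C a b g ξ d τ p K x₀ x)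
    (hk : k ∈ Set.Icc 1 K) : MemLp (sampleSubgradient g ξ d x k) 2 P :=
  memLp_two_of_lintegral_le (h.measurable_sampleSubgradient hk).aestronglyMeasurable
    (h.lintegral_sq_sampleSubgradient_le hk)

theorem integrable_sq_sampleSubgradient_add
    (h : IsInertialRun P μ F r ρ M C a b g ξ d τ p K x₀ x) (hk : k ∈ Set.Icc 1 K) :
    Integrable (fun ω => ‖sampleSubgradient g ξ d x k ω‖ ^ 2 + M ^ 2) P :=
  (h.memLp_sampleSubgradient hk).norm.integrable_sq.add (integrable_const _)

theorem integral_sq_sampleSubgradient_add_le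
    (h : IsInertialRun P μ F r ρ M C a b g ξ d τ p K x₀ x) (hk : k ∈ Set.Icc 1 K) :
    ∫ ω, (‖sampleSubgradient g ξ d x k ω‖ ^ 2 + M ^ 2) ∂P ≤ 2 * M ^ 2 := by
  rw [integral_add (h.memLp_sampleSubgradient hk).norm.integrable_sq (integrable_const _),
    integral_const, probReal_univ, one_smul, two_mul]
  gcongr
  exact integral_sq_norm_le_of_lintegral_le (h.memLp_sampleSubgradient hk).1 (sq_nonneg M)
    (h.lintegral_sq_sampleSubgradient_le hk)

theorem memLp_iterate (h : IsInertialRun P μ F r ρ M C a b g ξ d τ p K x₀ x)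
    (hk : k ≤ K + 1) : MemLp (x k) 2 P := by
  obtain ⟨L, pr, hlip, huniq⟩ := h.exists_lipschitz_prox
  exact h.iterates.memLp (fun _ _ => ⟨L, pr, hlip, huniq⟩)
    (fun k hk => h.memLp_sampleSubgradient hk) hk

theorem memLp_increment (h : IsInertialRun P μ F r ρ M C a b g ξ d τ p K x₀ x)
    (hk : k ≤ K + 1) : MemLp (fun ω => x k ω - x (k - 1) ω) 2 P :=
  (h.memLp_iterate hk).sub (h.memLp_iterate ((Nat.sub_le k 1).trans hk))

theorem memLp_sub_lipschitz_iterate (h : IsInertialRun P μ F r ρ M C a b g ξ d τ p K x₀ x)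
    (hk : k ≤ K + 1) {L : NNReal} {pr : Vec n → Vec n} (hpr : LipschitzWith L pr) :
    MemLp (fun ω => x k ω - pr (x k ω)) 2 P :=
  (h.memLp_iterate hk).sub (memLp_lipschitz_comp hpr (h.memLp_iterate hk))

theorem memLp_sub_delayed_iterate (h : IsInertialRun P μ F r ρ M C a b g ξ d τ p K x₀ x)
    (hk : k ∈ Set.Icc 1 K) : MemLp (fun ω => x k ω - x (k - d k ω) ω) 2 P := by
  have hk' : k ≤ K + 1 := Nat.le_succ_of_le hk.2
  have hsum : MemLp (fun ω => ∑ i ∈ Finset.range τ, ‖x (k - i) ω - x (k - i - 1) ω‖) 2 P :=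
    memLp_finsetSum _ fun i _ => (h.memLp_increment ((Nat.sub_le k i).trans hk')).norm
  refine hsum.of_le
    ((h.measurable_iterate hk').sub (h.measurable_delayed_iterate hk)).aestronglyMeasurable ?_
  filter_upwards [h.sampling.ae_delay_le hk] with ω hω
  exact (norm_sub_delayed_le (fun j => x j ω) k hω).trans (Real.le_norm_self _)

variable [IsProbabilityMeasure μ]

theorem integrable_loss_iterate (h : IsInertialRun P μ F r ρ M C a b g ξ d τ p K x₀ x)
    (hK : 1 ≤ K) (hk : k ≤ K + 1) : Integrable (fun ω => F (x k ω)) P := by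
  have hone : (1 : ℕ) ∈ Set.Icc 1 K := ⟨le_rfl, hK⟩
  have hdiff : MemLp (fun ω => x k ω - x₀) 2 P := (h.memLp_iterate hk).sub (memLp_const x₀)
  have hbound : Integrable (fun ω => M * ‖x k ω - x₀‖ + ρ / 2 * ‖x k ω - x₀‖ ^ 2) P :=
    ((hdiff.norm.integrable one_le_two).const_mul M).add (hdiff.norm.integrable_sq.const_mul _)
  have hFmeas : Measurable fun ω => F (x k ω) :=
    h.weaklyConvex.continuous.measurable.comp (h.measurable_iterate hk)
  have hsub : Integrable (fun ω => F (x k ω) - F x₀) P :=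
    hbound.mono' (hFmeas.sub_const _).aestronglyMeasurable <| Eventually.of_forall fun ω =>
      have hx := h.iterates.mem_effDom hk ω
      have hx₀ := h.iterates.start_mem
      abs_sub_le_of_mem_subdiff h.weaklyConvex.strongConvexOn
        (h.oracle_mean_mem 1 hone _ hx₀) (h.norm_oracle_mean_le hone hx₀)
        (h.oracle_mean_mem 1 hone _ hx) (h.norm_oracle_mean_le hone hx)
  simpa only [Pi.add_def, sub_add_cancel] using hsub.add (integrable_const (F x₀))

theorem integrable_loss_delayed_iterate (h : IsInertialRun P μ F r ρ M C a b g ξ d τ p K x₀ x)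
    (hk : k ∈ Set.Icc 1 K) : Integrable (fun ω => F (x (k - d k ω) ω)) P :=
  integrable_comp_random_index (h.sampling.measurable_delay k hk)
    (h.sampling.sum_measureReal_delay hk) (Φ := fun j ω => F (x (k - j) ω)) fun j _ =>
    h.integrable_loss_iterate (hk.1.trans hk.2)
      ((Nat.sub_le k j).trans (Nat.le_succ_of_le hk.2))

theorem integral_loss_delayed_iterate (h : IsInertialRun P μ F r ρ M C a b g ξ d τ p K x₀ x)
    (hk : k ∈ Set.Icc 1 K) :
    ∫ ω, F (x (k - d k ω) ω) ∂P =
      ∑ j ∈ Finset.range (τ + 1), p j * ∫ ω, F (x (k - j) ω) ∂P := by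
  have hkj : ∀ j, k - j ≤ K + 1 := fun j => (Nat.sub_le k j).trans (Nat.le_succ_of_le hk.2)
  have hind : ∀ j, IndepFun (d k) (fun ω => F (x (k - j) ω)) P := fun j =>
    have hpast : Measurable[pastSigma ξ d K k] fun ω => F (x (k - j) ω) :=
      h.weaklyConvex.continuous.measurable.comp
        (h.measurable_iterate_past (hkj j) (Nat.sub_le k j))
    have hpair : IndepFun (fun ω => F (x (k - j) ω)) (fun ω => (ξ k ω, d k ω)) P :=
      (IndepFun_iff_Indep _ _ _).2
        (indep_of_indep_of_le_left (h.sampling.indep_pastSigma hk) hpast.comap_le)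
    (hpair.comp measurable_id measurable_snd).symm
  rw [integral_comp_random_index (h.sampling.measurable_delay k hk)
    (h.sampling.sum_measureReal_delay hk) (Φ := fun j ω => F (x (k - j) ω))
    (fun j _ => h.integrable_loss_iterate (hk.1.trans hk.2) (hkj j)) fun j _ => hind j]
  refine Finset.sum_congr rfl fun j hj => ?_
  rw [h.sampling.law_delay k hk j (Finset.mem_range_succ_iff.1 hj)]

theorem integrable_noise (h : IsInertialRun P μ F r ρ M C a b g ξ d τ p K x₀ x)
    (hk : k ∈ Set.Icc 1 K) {L : NNReal} {pr : Vec n → Vec n} (hpr : LipschitzWith L pr) :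
    Integrable (fun ω => inner ℝ (x k ω - pr (x k ω))
      (∫ e, g k (x (k - d k ω) ω) e ∂μ - sampleSubgradient g ξ d x k ω)) P := by
  have hmean : MemLp (fun ω => ∫ e, g k (x (k - d k ω) ω) e ∂μ) 2 P :=
    MemLp.of_bound ((h.oracle_measurable k hk).stronglyMeasurable.integral_prod_right'
      |>.comp_measurable (h.measurable_delayed_iterate hk)).aestronglyMeasurable M
      (Eventually.of_forall fun ω =>
        h.norm_oracle_mean_le hk (h.delayed_iterate_mem_effDom hk ω))
  exact integrable_inner_of_memLp_two (h.memLp_sub_lipschitz_iterate (Nat.le_succ_of_le hk.2) hpr)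
    (hmean.sub (h.memLp_sampleSubgradient hk))

theorem integral_noise_eq_zero (h : IsInertialRun P μ F r ρ M C a b g ξ d τ p K x₀ x)
    (hk : k ∈ Set.Icc 1 K) {L : NNReal} {pr : Vec n → Vec n} (hpr : LipschitzWith L pr) :
    ∫ ω, inner ℝ (x k ω - pr (x k ω))
      (∫ e, g k (x (k - d k ω) ω) e ∂μ - sampleSubgradient g ξ d x k ω) ∂P = 0 := by
  let noise : Vec n × Vec n → Ξ → ℝ := fun q e =>
    inner ℝ (q.1 - pr q.1) (∫ e', g k q.2 e' ∂μ - g k q.2 e)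
  have hpair : Measurable fun q : (Vec n × Vec n) × Ξ => (q.1.2, q.2) := by fun_prop
  have hmean : Measurable fun q : (Vec n × Vec n) × Ξ => ∫ e, g k q.1.2 e ∂μ :=
    ((h.oracle_measurable k hk).stronglyMeasurable.integral_prod_right'.measurable).comp
      (measurable_snd.comp measurable_fst)
  have hnoise : StronglyMeasurable (Function.uncurry noise) :=
    (Measurable.inner (by have := hpr.continuous.measurable; fun_prop)
      (hmean.sub ((h.oracle_measurable k hk).comp hpair))).stronglyMeasurable
  have hfresh := integral_comp_of_indepFun hnoise
    ((h.measurable_iterate (Nat.le_succ_of_le hk.2)).prodMk (h.measurable_delayed_iterate hk))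
    (h.sampling.measurable_sample k hk) (h.indepFun_iterate_delayed_iterate hk)
    (h.integrable_noise hk hpr)
  refine hfresh.trans (integral_eq_zero_of_ae (Eventually.of_forall fun ω => ?_))
  have hint := (h.memLp_oracle hk (h.delayed_iterate_mem_effDom hk ω)).integrable one_le_two
  simp only [noise, h.sampling.law_sample k hk, Pi.zero_apply]
  have hcentered : Integrable (fun e => ∫ e', g k (x (k - d k ω) ω) e' ∂μ
      - g k (x (k - d k ω) ω) e) μ := (integrable_const _).sub hint
  rw [integral_inner hcentered, integral_sub (integrable_const _) hint,
    integral_const, probReal_univ, one_smul, sub_self, inner_zero_right]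

end IsInertialRun

/-! ### Summed error bounds -/

namespace IsInertialRun

variable {n : ℕ} {Ξ Ω : Type*} [MeasurableSpace Ξ] [MeasurableSpace Ω]
  {P : Measure Ω} {μ : Measure Ξ} {F : Vec n → ℝ} {r : Vec n → EReal} {ρ M C a b : ℝ}
  {g : ℕ → Vec n → Ξ → Vec n} {ξ : ℕ → Ω → Ξ} {d : ℕ → Ω → ℕ} {τ : ℕ} {p : ℕ → ℝ} {K k : ℕ}
  {x₀ : Vec n} {x : ℕ → Ω → Vec n} {ρ' B γ : ℝ} {L : NNReal} {pr : Vec n → Vec n}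

theorem toReal_optValue_le_objective_iterate
    (h : IsInertialRun P μ F r ρ M C a b g ξ d τ p K x₀ x) (hk : k ≤ K + 1) (ω : Ω) :
    (optValue (objective F r)).toReal ≤ (objective F r (x k ω)).toReal :=
  toReal_optValue_le h.optValue_ne_bot
    ((effDom_objective F r).symm ▸ h.iterates.mem_effDom hk ω)

theorem toReal_optValue_le_moreauEnvelope
    (h : IsInertialRun P μ F r ρ M C a b g ξ d τ p K x₀ x) (hρ' : ρ < ρ')
    (hpr : ∀ z, IsProx (1 / ρ') (objective F r) z (pr z)) (y : Vec n) :
    (optValue (objective F r)).toReal ≤ moreauEnvelope (1 / ρ') (objective F r) y := by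
  have hρ'_pos : 0 < ρ' := h.weaklyConvex.1.trans hρ'
  rw [(hpr y).moreauEnvelope_eq (objective_ne_bot F h.closedConvex.ne_bot)
    h.start_mem_effDom_objective]
  exact le_add_of_le_of_nonneg (toReal_optValue_le h.optValue_ne_bot
    ((hpr y).mem_effDom h.start_mem_effDom_objective)) (by positivity)

section Delay

variable [IsProbabilityMeasure P]

theorem integral_norm_sub_delayed_le (h : IsInertialRun P μ F r ρ M C a b g ξ d τ p K x₀ x)
    (hk : k ∈ Set.Icc 1 K) :
    ∫ ω, ‖x k ω - x (k - d k ω) ω‖ ∂P ≤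
      ∑ i ∈ Finset.range τ, √(∫ ω, ‖x (k - i) ω - x (k - i - 1) ω‖ ^ 2 ∂P) := by
  have hincr : ∀ i, MemLp (fun ω => ‖x (k - i) ω - x (k - i - 1) ω‖) 2 P := fun i =>
    (h.memLp_increment ((Nat.sub_le k i).trans (Nat.le_succ_of_le hk.2))).norm
  have hint : ∀ i ∈ Finset.range τ, Integrable (fun ω => ‖x (k - i) ω - x (k - i - 1) ω‖) P :=
    fun i _ => (hincr i).integrable one_le_two
  have hle : ∀ᵐ ω ∂P, ‖x k ω - x (k - d k ω) ω‖ ≤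
      ∑ i ∈ Finset.range τ, ‖x (k - i) ω - x (k - i - 1) ω‖ := by
    filter_upwards [h.sampling.ae_delay_le hk] with ω hω
    exact norm_sub_delayed_le (fun j => x j ω) k hω
  calc ∫ ω, ‖x k ω - x (k - d k ω) ω‖ ∂P
      ≤ ∫ ω, ∑ i ∈ Finset.range τ, ‖x (k - i) ω - x (k - i - 1) ω‖ ∂P :=
        integral_mono_ae ((h.memLp_sub_delayed_iterate hk).norm.integrable one_le_two)
          (integrable_finsetSum _ hint) hle
    _ = ∑ i ∈ Finset.range τ, ∫ ω, ‖x (k - i) ω - x (k - i - 1) ω‖ ∂P :=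
        integral_finsetSum _ hint
    _ ≤ ∑ i ∈ Finset.range τ, √(∫ ω, ‖x (k - i) ω - x (k - i - 1) ω‖ ^ 2 ∂P) :=
        Finset.sum_le_sum fun i _ => Real.le_sqrt_of_sq_le (sq_integral_le_integral_sq (hincr i))

theorem integral_sq_norm_sub_delayed_le
    (h : IsInertialRun P μ F r ρ M C a b g ξ d τ p K x₀ x) (hk : k ∈ Set.Icc 1 K) :
    ∫ ω, ‖x k ω - x (k - d k ω) ω‖ ^ 2 ∂P ≤
      τ * ∑ i ∈ Finset.range τ, ∫ ω, ‖x (k - i) ω - x (k - i - 1) ω‖ ^ 2 ∂P := by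
  have hint : ∀ i ∈ Finset.range τ,
      Integrable (fun ω => ‖x (k - i) ω - x (k - i - 1) ω‖ ^ 2) P := fun i _ =>
    (h.memLp_increment ((Nat.sub_le k i).trans (Nat.le_succ_of_le hk.2))).norm.integrable_sq
  rw [← integral_finsetSum _ hint, ← integral_const_mul]
  refine integral_mono_ae (h.memLp_sub_delayed_iterate hk).norm.integrable_sq
    ((integrable_finsetSum _ hint).const_mul _) ?_
  filter_upwards [h.sampling.ae_delay_le hk] with ω hω
  exact sq_norm_sub_delayed_le (fun j => x j ω) k hω

theorem sum_integral_norm_sub_delayed_le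
    (h : IsInertialRun P μ F r ρ M C a b g ξ d τ p K x₀ x)
    (hB : ∑ k ∈ Finset.Icc 1 K, ∫ ω, ‖x k ω - x (k - 1) ω‖ ^ 2 ∂P ≤ B) :
    ∑ k ∈ Finset.Icc 1 K, ∫ ω, ‖x k ω - x (k - d k ω) ω‖ ∂P ≤ τ * (√K * √B) := by
  let δ : ℕ → ℝ := fun k => √(∫ ω, ‖x k ω - x (k - 1) ω‖ ^ 2 ∂P)
  calc ∑ k ∈ Finset.Icc 1 K, ∫ ω, ‖x k ω - x (k - d k ω) ω‖ ∂P
      ≤ ∑ k ∈ Finset.Icc 1 K, ∑ i ∈ Finset.range τ, δ (k - i) :=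
        Finset.sum_le_sum fun k hk => h.integral_norm_sub_delayed_le (Finset.mem_Icc.1 hk)
    _ = ∑ i ∈ Finset.range τ, ∑ k ∈ Finset.Icc 1 K, δ (k - i) := Finset.sum_comm
    _ ≤ (Finset.range τ).card • (√K * √B) := Finset.sum_le_card_nsmul _ _ _ fun i _ =>
        (sum_Icc_delayed_le (fun k => Real.sqrt_nonneg _) (by simp) K i).trans
          (sum_Icc_sqrt_le (fun k => integral_nonneg fun ω => sq_nonneg _) hB)
    _ = τ * (√K * √B) := by rw [Finset.card_range, nsmul_eq_mul]

theorem sum_integral_sq_norm_sub_delayed_le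
    (h : IsInertialRun P μ F r ρ M C a b g ξ d τ p K x₀ x)
    (hB : ∑ k ∈ Finset.Icc 1 K, ∫ ω, ‖x k ω - x (k - 1) ω‖ ^ 2 ∂P ≤ B) :
    ∑ k ∈ Finset.Icc 1 K, ∫ ω, ‖x k ω - x (k - d k ω) ω‖ ^ 2 ∂P ≤ τ * (τ * B) := by
  let δ : ℕ → ℝ := fun k => ∫ ω, ‖x k ω - x (k - 1) ω‖ ^ 2 ∂P
  have hδ : ∀ k, 0 ≤ δ k := fun k => integral_nonneg fun ω => sq_nonneg _
  calc ∑ k ∈ Finset.Icc 1 K, ∫ ω, ‖x k ω - x (k - d k ω) ω‖ ^ 2 ∂P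
      ≤ ∑ k ∈ Finset.Icc 1 K, τ * ∑ i ∈ Finset.range τ, δ (k - i) :=
        Finset.sum_le_sum fun k hk => h.integral_sq_norm_sub_delayed_le (Finset.mem_Icc.1 hk)
    _ = τ * ∑ i ∈ Finset.range τ, ∑ k ∈ Finset.Icc 1 K, δ (k - i) := by
        rw [← Finset.mul_sum, Finset.sum_comm]
    _ ≤ τ * ((Finset.range τ).card • B) := by
        gcongr
        exact Finset.sum_le_card_nsmul _ _ _ fun i _ =>
          (sum_Icc_delayed_le hδ (by simp [δ]) K i).trans hB
    _ = τ * (τ * B) := by rw [Finset.card_range, nsmul_eq_mul]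

end Delay

variable [IsProbabilityMeasure μ]

theorem potential_iterate_le (h : IsInertialRun P μ F r ρ M C a b g ξ d τ p K x₀ x)
    (hγ : 0 < γ) (hγ2 : 2 * γ = 1 - a * ρ / 2 - b) (hk : k ∈ Set.Icc 1 K) (ω : Ω) :
    a * (objective F r (x (k + 1) ω)).toReal + b / 2 * ‖x (k + 1) ω - x k ω‖ ^ 2
        + γ * ‖x (k + 1) ω - x k ω‖ ^ 2 ≤
      a * (objective F r (x k ω)).toReal + b / 2 * ‖x k ω - x (k - 1) ω‖ ^ 2
        + a ^ 2 / (2 * γ) * (‖sampleSubgradient g ξ d x k ω‖ ^ 2 + M ^ 2) := by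
  have hx := h.iterates.mem_effDom (Nat.le_succ_of_le hk.2) ω
  have hx' := h.iterates.mem_effDom (Nat.succ_le_succ hk.2) ω
  have hstep := potential_step_le h.weaklyConvex h.closedConvex h.step_pos h.inertia_nonneg hγ hγ2
    hx (h.iterates.step k hk ω) (h.oracle_mean_mem k hk _ hx') (h.norm_oracle_mean_le hk hx')
  rw [sampleSubgradient]
  linarith

theorem moreauEnvelope_iterate_le (h : IsInertialRun P μ F r ρ M C a b g ξ d τ p K x₀ x)
    (hρ' : ρ < ρ') (haρ : a * ρ' ≤ 1) (hpr : ∀ z, IsProx (1 / ρ') (objective F r) z (pr z))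
    (hk : k ∈ Set.Icc 1 K) (ω : Ω) :
    moreauEnvelope (1 / ρ') (objective F r) (x (k + 1) ω)
        + ρ' / 2 * (a * (ρ' - ρ)) * ‖x k ω - pr (x k ω)‖ ^ 2 ≤
      moreauEnvelope (1 / ρ') (objective F r) (x k ω)
        + ρ' / 2 * (stepError F ρ ρ' M a b (x k ω) (x (k - 1) ω) (x (k - d k ω) ω)
            (sampleSubgradient g ξ d x k ω)
          + 2 * a * (1 - a * ρ') * inner ℝ (x k ω - pr (x k ω))
            (∫ e, g k (x (k - d k ω) ω) e ∂μ - sampleSubgradient g ξ d x k ω)) :=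
  moreauEnvelope_step_le (G := fun y => ∫ e, g k y e ∂μ) h.weaklyConvex h.closedConvex
    (h.oracle_mean_mem k hk) (fun _ hy => h.norm_oracle_mean_le hk hy) hρ' h.step_pos haρ
    (h.iterates.mem_effDom (Nat.le_succ_of_le hk.2) ω) (h.delayed_iterate_mem_effDom hk ω)
    (h.iterates.step k hk ω) (hpr _) (hpr _)

variable [IsProbabilityMeasure P]

theorem sum_integral_sq_succ_increment_le
    (h : IsInertialRun P μ F r ρ M C a b g ξ d τ p K x₀ x) (hγ : 0 < γ)
    (hγ2 : 2 * γ = 1 - a * ρ / 2 - b) :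
    ∑ k ∈ Finset.Icc 1 K, ∫ ω, ‖x (k + 1) ω - x k ω‖ ^ 2 ∂P ≤
      a / γ * ((objective F r x₀).toReal - (optValue (objective F r)).toReal)
        + K * a ^ 2 * M ^ 2 / γ ^ 2 := by
  have hinertia := h.inertia_nonneg
  have htele := sum_integral_le_of_step_le (P := P) (K := K)
    (pot := fun k ω => a * (objective F r (x k ω)).toReal + b / 2 * ‖x k ω - x (k - 1) ω‖ ^ 2)
    (s := fun k ω => γ * ‖x (k + 1) ω - x k ω‖ ^ 2)
    (m := fun k ω => a ^ 2 / (2 * γ) * (‖sampleSubgradient g ξ d x k ω‖ ^ 2 + M ^ 2))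
    (c := a * (objective F r x₀).toReal) (c' := a * (optValue (objective F r)).toReal)
    (fun k hk => (h.memLp_increment (k := k + 1)
      (Nat.succ_le_succ (Finset.mem_Icc.1 hk).2)).norm.integrable_sq.const_mul γ)
    (fun k hk => (h.integrable_sq_sampleSubgradient_add (Finset.mem_Icc.1 hk)).const_mul _)
    (fun k hk ω => h.potential_iterate_le hγ hγ2 (Finset.mem_Icc.1 hk) ω)
    (fun ω => by simp [h.iterates.one, h.iterates.zero])
    (fun ω => le_add_of_le_of_nonneg (mul_le_mul_of_nonneg_left
      (h.toReal_optValue_le_objective_iterate le_rfl ω) h.step_pos.le) (by positivity))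
  have hmoment : ∀ k ∈ Finset.Icc 1 K,
      ∫ ω, a ^ 2 / (2 * γ) * (‖sampleSubgradient g ξ d x k ω‖ ^ 2 + M ^ 2) ∂P ≤
        a ^ 2 / (2 * γ) * (2 * M ^ 2) := fun k hk => by
    rw [integral_const_mul]
    gcongr
    exact h.integral_sq_sampleSubgradient_add_le (Finset.mem_Icc.1 hk)
  simp only [integral_const_mul γ, ← Finset.mul_sum] at htele
  refine le_of_mul_le_mul_left (htele.trans
    ((add_le_add_right (Finset.sum_le_card_nsmul _ _ _ hmoment) _).trans_eq ?_)) hγ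
  rw [Nat.card_Icc, Nat.add_sub_cancel, nsmul_eq_mul]
  field_simp

theorem sum_integral_sq_increment_le
    (h : IsInertialRun P μ F r ρ M C a b g ξ d τ p K x₀ x) (hγ : 0 < γ)
    (hγ2 : 2 * γ = 1 - a * ρ / 2 - b) :
    ∑ k ∈ Finset.Icc 1 K, ∫ ω, ‖x k ω - x (k - 1) ω‖ ^ 2 ∂P ≤
      a / γ * ((objective F r x₀).toReal - (optValue (objective F r)).toReal)
        + K * a ^ 2 * M ^ 2 / γ ^ 2 := by
  have hshift := sum_Icc_sub_one_add (fun k => ∫ ω, ‖x (k + 1) ω - x k ω‖ ^ 2 ∂P) K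
  have hindex : ∑ k ∈ Finset.Icc 1 K, ∫ ω, ‖x (k - 1 + 1) ω - x (k - 1) ω‖ ^ 2 ∂P =
      ∑ k ∈ Finset.Icc 1 K, ∫ ω, ‖x k ω - x (k - 1) ω‖ ^ 2 ∂P :=
    Finset.sum_congr rfl fun k hk => by rw [Nat.sub_add_cancel (Finset.mem_Icc.1 hk).1]
  have hfirst : ∫ ω, ‖x (0 + 1) ω - x 0 ω‖ ^ 2 ∂P = 0 := by
    simp [h.iterates.one, h.iterates.zero]
  have hlast : 0 ≤ ∫ ω, ‖x (K + 1) ω - x K ω‖ ^ 2 ∂P := integral_nonneg fun ω => sq_nonneg _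
  linarith [h.sum_integral_sq_succ_increment_le hγ hγ2]

theorem integral_loss_iterate_le (h : IsInertialRun P μ F r ρ M C a b g ξ d τ p K x₀ x)
    (hK : 1 ≤ K) (hk : k ≤ K + 1) : ∫ ω, F (x k ω) ∂P ≤ C := by
  simpa only [integral_const, probReal_univ, one_smul] using
    integral_mono (h.integrable_loss_iterate hK hk) (integrable_const C) fun ω =>
      h.loss_le _ (h.iterates.mem_effDom hk ω)

theorem sum_loss_sub_delayed_le (h : IsInertialRun P μ F r ρ M C a b g ξ d τ p K x₀ x)
    (hK : 1 ≤ K) :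
    ∑ k ∈ Finset.Icc 1 K, (∫ ω, F (x k ω) ∂P - ∫ ω, F (x (k - d k ω) ω) ∂P) ≤
      τ * (C - F x₀) := by
  let f : ℕ → ℝ := fun k => ∫ ω, F (x k ω) ∂P
  have hf₀ : f 0 = F x₀ := by simp [f, h.iterates.zero]
  have hfC : ∀ k ≤ K, f k ≤ C := fun k hk =>
    h.integral_loss_iterate_le hK (Nat.le_succ_of_le hk)
  have hp : ∀ j ∈ Finset.range (τ + 1), 0 ≤ p j := fun j hj =>
    h.sampling.law_delay 1 ⟨le_rfl, hK⟩ j (Finset.mem_range_succ_iff.1 hj) ▸ measureReal_nonneg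
  have hsum := h.sampling.sum_law_delay
  have hgap : 0 ≤ C - F x₀ := sub_nonneg.2 (h.loss_le _ h.iterates.start_mem)
  have hdelay : ∀ j ∈ Finset.range (τ + 1),
      ∑ k ∈ Finset.Icc 1 K, (f k - f (k - j)) ≤ τ * (C - F x₀) := fun j hj => by
    refine (sum_Icc_sub_delayed_le hfC j).trans ?_
    rw [hf₀]
    gcongr
    exact Finset.mem_range_succ_iff.1 hj
  calc ∑ k ∈ Finset.Icc 1 K, (∫ ω, F (x k ω) ∂P - ∫ ω, F (x (k - d k ω) ω) ∂P)
      = ∑ k ∈ Finset.Icc 1 K, ∑ j ∈ Finset.range (τ + 1), p j * (f k - f (k - j)) := by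
        refine Finset.sum_congr rfl fun k hk => ?_
        rw [h.integral_loss_delayed_iterate (Finset.mem_Icc.1 hk)]
        simp only [mul_sub, Finset.sum_sub_distrib, ← Finset.sum_mul, hsum, one_mul, f]
    _ = ∑ j ∈ Finset.range (τ + 1), p j * ∑ k ∈ Finset.Icc 1 K, (f k - f (k - j)) := by
        rw [Finset.sum_comm]
        simp only [Finset.mul_sum]
    _ ≤ ∑ j ∈ Finset.range (τ + 1), p j * (τ * (C - F x₀)) :=
        Finset.sum_le_sum fun j hj => mul_le_mul_of_nonneg_left (hdelay j hj) (hp j hj)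
    _ = τ * (C - F x₀) := by rw [← Finset.sum_mul, hsum, one_mul]

theorem integrable_loss_sub_delayed (h : IsInertialRun P μ F r ρ M C a b g ξ d τ p K x₀ x)
    (hk : k ∈ Set.Icc 1 K) : Integrable (fun ω => F (x k ω) - F (x (k - d k ω) ω)) P :=
  (h.integrable_loss_iterate (hk.1.trans hk.2) (Nat.le_succ_of_le hk.2)).sub
    (h.integrable_loss_delayed_iterate hk)

theorem integrable_delayError (h : IsInertialRun P μ F r ρ M C a b g ξ d τ p K x₀ x) (ρ' : ℝ)
    (hk : k ∈ Set.Icc 1 K) :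
    Integrable (fun ω => delayError F ρ ρ' M (x k ω) (x (k - d k ω) ω)) P :=
  have hdist := (h.memLp_sub_delayed_iterate hk).norm
  ((h.integrable_loss_sub_delayed hk).add ((hdist.integrable one_le_two).const_mul M)).add
    (hdist.integrable_sq.const_mul _)

theorem integral_delayError (h : IsInertialRun P μ F r ρ M C a b g ξ d τ p K x₀ x) (ρ' : ℝ)
    (hk : k ∈ Set.Icc 1 K) :
    ∫ ω, delayError F ρ ρ' M (x k ω) (x (k - d k ω) ω) ∂P =
      ∫ ω, F (x k ω) ∂P - ∫ ω, F (x (k - d k ω) ω) ∂P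
        + M * ∫ ω, ‖x k ω - x (k - d k ω) ω‖ ∂P
        + (ρ / 2 + ρ ^ 2 / (ρ' - ρ)) * ∫ ω, ‖x k ω - x (k - d k ω) ω‖ ^ 2 ∂P := by
  have hdist := (h.memLp_sub_delayed_iterate hk).norm
  have hloss := h.integrable_loss_sub_delayed hk
  have hnorm := (hdist.integrable one_le_two).const_mul M
  have hfirst : Integrable (fun ω => F (x k ω) - F (x (k - d k ω) ω)
      + M * ‖x k ω - x (k - d k ω) ω‖) P := hloss.add hnorm
  simp only [delayError]
  rw [integral_add hfirst (hdist.integrable_sq.const_mul _), integral_add hloss hnorm,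
    integral_sub (h.integrable_loss_iterate (hk.1.trans hk.2) (Nat.le_succ_of_le hk.2))
      (h.integrable_loss_delayed_iterate hk), integral_const_mul, integral_const_mul]

theorem sum_integral_delayError_le (h : IsInertialRun P μ F r ρ M C a b g ξ d τ p K x₀ x)
    (hK : 1 ≤ K) (hρ' : ρ < ρ')
    (hB : ∑ k ∈ Finset.Icc 1 K, ∫ ω, ‖x k ω - x (k - 1) ω‖ ^ 2 ∂P ≤ B) :
    ∑ k ∈ Finset.Icc 1 K, ∫ ω, delayError F ρ ρ' M (x k ω) (x (k - d k ω) ω) ∂P ≤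
      τ * (C - F x₀) + M * (τ * (√K * √B)) + (ρ / 2 + ρ ^ 2 / (ρ' - ρ)) * (τ * (τ * B)) := by
  have hM := h.bound_nonneg
  have hρ := h.weaklyConvex.1
  have : 0 < ρ' - ρ := sub_pos.2 hρ'
  rw [Finset.sum_congr rfl fun k hk => h.integral_delayError ρ' (Finset.mem_Icc.1 hk),
    Finset.sum_add_distrib, Finset.sum_add_distrib, ← Finset.mul_sum, ← Finset.mul_sum]
  gcongr
  · exact h.sum_loss_sub_delayed_le hK
  · exact h.sum_integral_norm_sub_delayed_le hB
  · exact h.sum_integral_sq_norm_sub_delayed_le hB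

theorem integrable_stepError (h : IsInertialRun P μ F r ρ M C a b g ξ d τ p K x₀ x) (ρ' : ℝ)
    (hk : k ∈ Set.Icc 1 K) :
    Integrable (fun ω => stepError F ρ ρ' M a b (x k ω) (x (k - 1) ω) (x (k - d k ω) ω)
      (sampleSubgradient g ξ d x k ω)) P :=
  have hincr := (h.memLp_increment (Nat.le_succ_of_le hk.2)).norm.integrable_sq
  (((hincr.const_mul _).const_mul _).add
    ((h.integrable_sq_sampleSubgradient_add hk).const_mul _)).add
      ((h.integrable_delayError ρ' hk).const_mul _)

theorem integral_stepError_le (h : IsInertialRun P μ F r ρ M C a b g ξ d τ p K x₀ x) (ρ' : ℝ)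
    (hk : k ∈ Set.Icc 1 K) :
    ∫ ω, stepError F ρ ρ' M a b (x k ω) (x (k - 1) ω) (x (k - d k ω) ω)
        (sampleSubgradient g ξ d x k ω) ∂P ≤
      (2 + 2 / (a * (ρ' - ρ))) * (b ^ 2 * ∫ ω, ‖x k ω - x (k - 1) ω‖ ^ 2 ∂P)
        + 8 * a ^ 2 * M ^ 2
        + 2 * a * (1 - a * ρ') *
          ∫ ω, delayError F ρ ρ' M (x k ω) (x (k - d k ω) ω) ∂P := by
  have hincr := (((h.memLp_increment (Nat.le_succ_of_le hk.2)).norm.integrable_sq.const_mul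
    (b ^ 2)).const_mul (2 + 2 / (a * (ρ' - ρ))))
  have hsub := (h.integrable_sq_sampleSubgradient_add hk).const_mul (4 * a ^ 2)
  have hfirst : Integrable (fun ω => (2 + 2 / (a * (ρ' - ρ))) * (b ^ 2 * ‖x k ω - x (k - 1) ω‖ ^ 2)
      + 4 * a ^ 2 * (‖sampleSubgradient g ξ d x k ω‖ ^ 2 + M ^ 2)) P := hincr.add hsub
  simp only [stepError]
  rw [integral_add hfirst ((h.integrable_delayError ρ' hk).const_mul _),
    integral_add hincr hsub]
  simp only [integral_const_mul]
  linarith [mul_le_mul_of_nonneg_left (h.integral_sq_sampleSubgradient_add_le hk)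
    (show 0 ≤ 4 * a ^ 2 by positivity)]

theorem sum_integral_stepError_le (h : IsInertialRun P μ F r ρ M C a b g ξ d τ p K x₀ x)
    (hK : 1 ≤ K) (hρ' : ρ < ρ') (haρ : a * ρ' ≤ 1)
    (hB : ∑ k ∈ Finset.Icc 1 K, ∫ ω, ‖x k ω - x (k - 1) ω‖ ^ 2 ∂P ≤ B) :
    ∑ k ∈ Finset.Icc 1 K, ∫ ω, stepError F ρ ρ' M a b (x k ω) (x (k - 1) ω) (x (k - d k ω) ω)
        (sampleSubgradient g ξ d x k ω) ∂P ≤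
      (2 + 2 / (a * (ρ' - ρ))) * (b ^ 2 * B) + K * (8 * a ^ 2 * M ^ 2)
        + 2 * a * (τ * (C - F x₀) + M * (τ * (√K * √B))
          + (ρ / 2 + ρ ^ 2 / (ρ' - ρ)) * (τ * (τ * B))) := by
  have ha := h.step_pos
  have hM := h.bound_nonneg
  have hρ := h.weaklyConvex.1
  have : 0 < ρ' - ρ := sub_pos.2 hρ'
  have hρ'_pos : 0 < ρ' := hρ.trans hρ'
  have hB₀ : 0 ≤ B :=
    (Finset.sum_nonneg fun k _ => integral_nonneg fun ω => sq_nonneg _).trans hB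
  have hC : 0 ≤ C - F x₀ := sub_nonneg.2 (h.loss_le _ h.iterates.start_mem)
  refine (Finset.sum_le_sum fun k hk => h.integral_stepError_le ρ' (Finset.mem_Icc.1 hk)).trans ?_
  rw [Finset.sum_add_distrib, Finset.sum_add_distrib, Finset.sum_const, Nat.card_Icc,
    Nat.add_sub_cancel, nsmul_eq_mul, ← Finset.mul_sum, ← Finset.mul_sum, ← Finset.mul_sum]
  have hcoef : 0 ≤ 2 * a * (1 - a * ρ') := mul_nonneg (by positivity) (sub_nonneg.2 haρ)
  have hcoef_le : 2 * a * (1 - a * ρ') ≤ 2 * a :=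
    mul_le_of_le_one_right (by positivity) (sub_le_self _ (by positivity))
  gcongr ?_ + _ + ?_
  · gcongr
  · exact (mul_le_mul_of_nonneg_left (h.sum_integral_delayError_le hK hρ' hB) hcoef).trans
      (mul_le_mul_of_nonneg_right hcoef_le (by positivity))

theorem integrable_stepError_add_noise (h : IsInertialRun P μ F r ρ M C a b g ξ d τ p K x₀ x)
    (ρ' : ℝ) (hlip : LipschitzWith L pr) (hk : k ∈ Set.Icc 1 K) :
    Integrable (fun ω => stepError F ρ ρ' M a b (x k ω) (x (k - 1) ω) (x (k - d k ω) ω)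
        (sampleSubgradient g ξ d x k ω)
      + 2 * a * (1 - a * ρ') * inner ℝ (x k ω - pr (x k ω))
        (∫ e, g k (x (k - d k ω) ω) e ∂μ - sampleSubgradient g ξ d x k ω)) P :=
  (h.integrable_stepError ρ' hk).add ((h.integrable_noise hk hlip).const_mul _)

theorem integral_stepError_add_noise (h : IsInertialRun P μ F r ρ M C a b g ξ d τ p K x₀ x)
    (ρ' : ℝ) (hlip : LipschitzWith L pr) (hk : k ∈ Set.Icc 1 K) :
    ∫ ω, (stepError F ρ ρ' M a b (x k ω) (x (k - 1) ω) (x (k - d k ω) ω)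
        (sampleSubgradient g ξ d x k ω)
      + 2 * a * (1 - a * ρ') * inner ℝ (x k ω - pr (x k ω))
        (∫ e, g k (x (k - d k ω) ω) e ∂μ - sampleSubgradient g ξ d x k ω)) ∂P =
    ∫ ω, stepError F ρ ρ' M a b (x k ω) (x (k - 1) ω) (x (k - d k ω) ω)
      (sampleSubgradient g ξ d x k ω) ∂P := by
  rw [integral_add (h.integrable_stepError ρ' hk) ((h.integrable_noise hk hlip).const_mul _),
    integral_const_mul, h.integral_noise_eq_zero hk hlip, mul_zero, add_zero]

theorem sum_integral_sq_residual_le (h : IsInertialRun P μ F r ρ M C a b g ξ d τ p K x₀ x)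
    (hK : 1 ≤ K) (hρ' : ρ < ρ') (haρ : a * ρ' ≤ 1)
    (hB : ∑ k ∈ Finset.Icc 1 K, ∫ ω, ‖x k ω - x (k - 1) ω‖ ^ 2 ∂P ≤ B)
    (hlip : LipschitzWith L pr) (hpr : ∀ z, IsProx (1 / ρ') (objective F r) z (pr z)) :
    ρ' / 2 * (a * (ρ' - ρ)) * ∑ k ∈ Finset.Icc 1 K, ∫ ω, ‖x k ω - pr (x k ω)‖ ^ 2 ∂P ≤
      ρ' / 2 * (2 + 2 / (a * (ρ' - ρ))) * b ^ 2 * B + 4 * ρ' * M ^ 2 * (K * a ^ 2)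
        + a * ρ' * τ * (C - F x₀ + τ * (ρ / 2 + ρ ^ 2 / (ρ' - ρ)) * B)
        + (moreauEnvelope (1 / ρ') (objective F r) x₀ - (optValue (objective F r)).toReal)
        + M * a * ρ' * τ * (√K * √B) := by
  have hρ'_half : 0 ≤ ρ' / 2 := (half_pos (h.weaklyConvex.1.trans hρ')).le
  have htele := sum_integral_le_of_step_le (P := P) (K := K)
    (pot := fun k ω => moreauEnvelope (1 / ρ') (objective F r) (x k ω))
    (fun k hk => (h.memLp_sub_lipschitz_iterate (Nat.le_succ_of_le (Finset.mem_Icc.1 hk).2)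
      hlip).norm.integrable_sq.const_mul _)
    (fun k hk => (h.integrable_stepError_add_noise ρ' hlip (Finset.mem_Icc.1 hk)).const_mul _)
    (fun k hk ω => h.moreauEnvelope_iterate_le hρ' haρ hpr (Finset.mem_Icc.1 hk) ω)
    (fun ω => by rw [h.iterates.one])
    (fun ω => h.toReal_optValue_le_moreauEnvelope hρ' hpr (x (K + 1) ω))
  simp only [integral_const_mul, ← Finset.mul_sum] at htele
  rw [Finset.sum_congr rfl fun k hk =>
    h.integral_stepError_add_noise ρ' hlip (Finset.mem_Icc.1 hk)] at htele
  linear_combination htele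
    + mul_le_mul_of_nonneg_left (h.sum_integral_stepError_le hK hρ' haρ hB) hρ'_half

end IsInertialRun

/-! ### The constants of the rate -/

section Rate

theorem tendsto_sqrt_natCast_atTop : Tendsto (fun N : ℕ => √(N : ℝ)) atTop atTop :=
  Real.tendsto_sqrt_atTop.comp tendsto_natCast_atTop_atTop

theorem tendsto_gam (ρ α β : ℝ) : Tendsto (gam ρ α β) atTop (𝓝 (1 / 2)) := by
  have hstep : Tendsto (fun N : ℕ => α * ρ / (2 * √(N : ℝ))) atTop (𝓝 0) :=
    (tendsto_sqrt_natCast_atTop.const_mul_atTop two_pos).const_div_atTop _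
  have hinertia : Tendsto (fun N : ℕ => β / (N : ℝ) ^ (1 / 4 : ℝ)) atTop (𝓝 0) :=
    ((tendsto_rpow_atTop (by norm_num : (0 : ℝ) < 1 / 4)).comp
      tendsto_natCast_atTop_atTop).const_div_atTop _
  have hlim := ((hstep.const_sub 1).sub hinertia).const_mul (1 / 2)
  rw [sub_zero, sub_zero, mul_one] at hlim
  exact hlim

theorem tendsto_moveBound (ρ α β M φ₁ φs : ℝ) :
    Tendsto (moveBound ρ α β M φ₁ φs) atTop (𝓝 (α ^ 2 * M ^ 2 / (1 / 2) ^ 2)) := by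
  have hgam := tendsto_gam ρ α β
  have hden : Tendsto (fun N : ℕ => gam ρ α β N * √(N : ℝ)) atTop atTop :=
    hgam.pos_mul_atTop one_half_pos tendsto_sqrt_natCast_atTop
  have hquot : Tendsto (fun N => α ^ 2 * M ^ 2 / gam ρ α β N ^ 2) atTop
      (𝓝 (α ^ 2 * M ^ 2 / (1 / 2) ^ 2)) :=
    tendsto_const_nhds.div (hgam.pow 2) (by norm_num)
  have hlim := ((hden.const_div_atTop α).mul_const (φ₁ - φs)).add hquot
  rw [zero_mul, zero_add] at hlim
  exact hlim

theorem tendsto_inertia_coeff (β : ℝ) {c : ℝ} (hc : c ≠ 0) :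
    Tendsto (fun N : ℕ => (2 + 2 * √(N : ℝ) / c) * (β ^ 2 / √(N : ℝ))) atTop
      (𝓝 (2 * β ^ 2 / c)) := by
  have hlim : Tendsto (fun N : ℕ => 2 * β ^ 2 / √(N : ℝ) + 2 * β ^ 2 / c) atTop
      (𝓝 (2 * β ^ 2 / c)) := by
    simpa only [zero_add] using
      (tendsto_sqrt_natCast_atTop.const_div_atTop (2 * β ^ 2)).add_const (2 * β ^ 2 / c)
  refine hlim.congr' ?_
  filter_upwards [tendsto_sqrt_natCast_atTop.eventually_gt_atTop 0] with N hN
  field_simp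

theorem isBigO_rateBound {ρ ρ' α : ℝ} (β M CF : ℝ) (τ : ℕ) (F₁ φ₁ e₁ φs : ℝ) (hα : 0 < α)
    (hρ' : ρ < ρ') :
    (fun N : ℕ => rateBound ρ ρ' α β M CF τ F₁ φ₁ e₁ φs N) =O[atTop]
      fun N : ℕ => 1 / √(N : ℝ) := by
  have hmove := tendsto_moveBound ρ α β M φ₁ φs
  have hinertia := ((tendsto_inertia_coeff β (mul_pos hα (sub_pos.2 hρ')).ne').const_mul
    (ρ' / 2)).mul hmove
  have hdelay := (tendsto_sqrt_natCast_atTop.const_div_atTop (α * ρ' * τ)).mul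
    ((hmove.const_mul (τ * (ρ / 2 + ρ ^ 2 / (ρ' - ρ)))).const_add (max 0 (-F₁) + CF))
  have hbracket := (((hinertia.add_const (4 * ρ' * M ^ 2 * α ^ 2)).add hdelay).add_const
    (e₁ - φs)).add (hmove.sqrt.const_mul (M * α * ρ' * τ))
  have hfactor : (fun N : ℕ => 2 * ρ' / ((ρ' - ρ) * α * √(N : ℝ))) =O[atTop]
      fun N : ℕ => 1 / √(N : ℝ) :=
    ((isBigO_refl _ _).const_mul_left (2 * ρ' / ((ρ' - ρ) * α))).congr_left fun N => by
      rw [div_mul_div_comm, mul_one]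
  refine (hfactor.mul (hbracket.isBigO_one ℝ)).congr (fun N => ?_) fun N => mul_one _
  rw [rateBound]
  ring

variable {ρ α β : ℝ} {K : ℕ}

theorem two_mul_gam (ρ α β : ℝ) (K : ℕ) :
    2 * gam ρ α β K = 1 - α / √(K : ℝ) * ρ / 2 - β / (K : ℝ) ^ (1 / 4 : ℝ) := by
  rw [gam]
  ring

theorem gam_pos (hβ : β / (K : ℝ) ^ (1 / 4 : ℝ) < 1 - α * ρ / (2 * √(K : ℝ))) :
    0 < gam ρ α β K :=
  mul_pos one_half_pos (sub_pos.2 hβ)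

theorem inertia_sq (β : ℝ) (K : ℕ) :
    (β / (K : ℝ) ^ (1 / 4 : ℝ)) ^ 2 = β ^ 2 / √(K : ℝ) := by
  rw [div_pow, ← Real.rpow_mul_natCast K.cast_nonneg, Real.sqrt_eq_rpow]
  norm_num

theorem natCast_mul_step_sq (hK : 1 ≤ K) (α : ℝ) : K * (α / √(K : ℝ)) ^ 2 = α ^ 2 := by
  have hK₀ : (K : ℝ) ≠ 0 := by positivity
  rw [div_pow, Real.sq_sqrt K.cast_nonneg, mul_div_cancel₀ _ hK₀]

theorem moveBound_eq (hK : 1 ≤ K) (ρ α β M φ₁ φs : ℝ) :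
    moveBound ρ α β M φ₁ φs K = α / √(K : ℝ) / gam ρ α β K * (φ₁ - φs)
      + K * (α / √(K : ℝ)) ^ 2 * M ^ 2 / gam ρ α β K ^ 2 := by
  rw [moveBound, natCast_mul_step_sq hK, div_div, mul_comm (√(K : ℝ))]

theorem rateBound_eq (hK : 1 ≤ K) (ρ ρ' α β M CF : ℝ) (τ : ℕ) (F₁ φ₁ e₁ φs : ℝ) {a b B : ℝ}
    (ha : a = α / √(K : ℝ)) (hb : b = β / (K : ℝ) ^ (1 / 4 : ℝ))
    (hB : B = moveBound ρ α β M φ₁ φs K) :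
    rateBound ρ ρ' α β M CF τ F₁ φ₁ e₁ φs K = 2 * ρ' / ((ρ' - ρ) * a * K) *
      (ρ' / 2 * (2 + 2 / (a * (ρ' - ρ))) * b ^ 2 * B + 4 * ρ' * M ^ 2 * (K * a ^ 2)
        + a * ρ' * τ * (max 0 (-F₁) + CF + τ * (ρ / 2 + ρ ^ 2 / (ρ' - ρ)) * B)
        + (e₁ - φs) + M * a * ρ' * τ * (√(K : ℝ) * √B)) := by
  have hsqrt : √(K : ℝ) ≠ 0 := by positivity
  have hα : α = a * √(K : ℝ) := by rw [ha, div_mul_cancel₀ _ hsqrt]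
  have hsq : (K : ℝ) = √(K : ℝ) * √(K : ℝ) := (Real.mul_self_sqrt K.cast_nonneg).symm
  have hfactor : (ρ' - ρ) * α * √(K : ℝ) = (ρ' - ρ) * a * K := by
    rw [hα, mul_assoc, mul_assoc a, ← hsq, mul_assoc]
  have hinertia : 2 * √(K : ℝ) / (α * (ρ' - ρ)) = 2 / (a * (ρ' - ρ)) := by
    rw [hα, mul_right_comm, mul_div_mul_right _ _ hsqrt]
  have hdelay : α * ρ' * τ / √(K : ℝ) = a * ρ' * τ := by
    rw [ha]
    ring
  have hfluct : M * α * ρ' * τ * √B = M * a * ρ' * τ * (√(K : ℝ) * √B) := by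
    rw [hα]
    ring
  rw [rateBound, ← hB, hfactor, hinertia, hdelay, hfluct, hb, inertia_sq, ha,
    natCast_mul_step_sq hK]

end Rate

theorem IsIterateSequence.congr {n : ℕ} {Ξ Ω : Type*} {r : Vec n → EReal}
    {g : ℕ → Vec n → Ξ → Vec n} {a a' b b' : ℕ → ℝ} {ξ : ℕ → Ω → Ξ} {d : ℕ → Ω → ℕ} {K : ℕ}
    {x₀ : Vec n} {x : ℕ → Ω → Vec n}
    (hx : IsIterateSequence r g a b ξ d K x₀ x) (ha : ∀ k ∈ Set.Icc 1 K, a k = a' k)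
    (hb : ∀ k ∈ Set.Icc 1 K, b k = b' k) : IsIterateSequence r g a' b' ξ d K x₀ x where
  start_mem := hx.start_mem
  zero := hx.zero
  one := hx.one
  step k hk ω := by simpa only [ha k hk, hb k hk] using hx.step k hk ω

section RandomIndex

variable {Ξ Ω : Type*} [MeasurableSpace Ξ] [MeasurableSpace Ω] {P : Measure Ω} {K : ℕ}
  {ξ : ℕ → Ω → Ξ} {d : ℕ → Ω → ℕ} {T : Ω → ℕ}

theorem IsRandomIndex.congr {a a' : ℕ → ℝ} (hT : IsRandomIndex P a K ξ d T)
    (ha : ∀ k ∈ Set.Icc 1 K, a k = a' k) : IsRandomIndex P a' K ξ d T where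
  measurable := hT.measurable
  law k hk := by
    rw [hT.law k hk, ha k hk, Finset.sum_congr rfl fun j hj => ha j (Finset.mem_Icc.1 hj)]
  indep := hT.indep

theorem IsRandomIndex.law_const {a : ℝ} (hT : IsRandomIndex P (fun _ => a) K ξ d T) (ha : a ≠ 0)
    {k : ℕ} (hk : k ∈ Finset.Icc 1 K) : P.real {ω | T ω = k} = 1 / K := by
  rw [hT.law k (Finset.mem_Icc.1 hk), Finset.sum_const, Nat.card_Icc, Nat.add_sub_cancel,
    nsmul_eq_mul, div_mul_cancel_right₀ ha, one_div]

theorem IsRandomIndex.sum_law_const {a : ℝ} (hT : IsRandomIndex P (fun _ => a) K ξ d T)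
    (ha : a ≠ 0) (hK : 1 ≤ K) : ∑ k ∈ Finset.Icc 1 K, P.real {ω | T ω = k} = 1 := by
  have hK₀ : (K : ℝ) ≠ 0 := by positivity
  rw [Finset.sum_congr rfl fun k => hT.law_const ha, Finset.sum_const, Nat.card_Icc,
    Nat.add_sub_cancel, nsmul_eq_mul, mul_one_div_cancel hK₀]

end RandomIndex

namespace IsInertialRun

variable {n : ℕ} {Ξ Ω : Type*} [MeasurableSpace Ξ] [MeasurableSpace Ω]
  {P : Measure Ω} {μ : Measure Ξ} {F : Vec n → ℝ} {r : Vec n → EReal} {ρ M C : ℝ}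
  {g : ℕ → Vec n → Ξ → Vec n} {ξ : ℕ → Ω → Ξ} {d : ℕ → Ω → ℕ} {τ : ℕ} {p : ℕ → ℝ} {K : ℕ}
  {x₀ : Vec n} {x : ℕ → Ω → Vec n} {T : Ω → ℕ}

section Gradient

variable {ρ' a b : ℝ}

theorem differentiable_moreauEnvelope (h : IsInertialRun P μ F r ρ M C a b g ξ d τ p K x₀ x)
    (hρ' : ρ < ρ') : Differentiable ℝ (moreauEnvelope (1 / ρ') (objective F r)) := by
  obtain ⟨-, pr, -, hpr⟩ := h.exists_lipschitz_prox_objective hρ'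
  exact fun y => (h.hasGradientAt_moreauEnvelope hρ' hpr y).differentiableAt

theorem sq_norm_gradient_moreauEnvelope
    (h : IsInertialRun P μ F r ρ M C a b g ξ d τ p K x₀ x) (hρ' : ρ < ρ') {pr : Vec n → Vec n}
    (hpr : ∀ z, IsProx (1 / ρ') (objective F r) z (pr z)) (y : Vec n) :
    ‖gradient (moreauEnvelope (1 / ρ') (objective F r)) y‖ ^ 2 = ρ' ^ 2 * ‖y - pr y‖ ^ 2 := by
  rw [(h.hasGradientAt_moreauEnvelope hρ' hpr y).gradient, norm_smul, mul_pow, Real.norm_eq_abs,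
    sq_abs]

variable [IsProbabilityMeasure P]

theorem integrable_sq_norm_gradient_iterate
    (h : IsInertialRun P μ F r ρ M C a b g ξ d τ p K x₀ x) (hρ' : ρ < ρ') {k : ℕ}
    (hk : k ≤ K + 1) :
    Integrable (fun ω => ‖gradient (moreauEnvelope (1 / ρ') (objective F r)) (x k ω)‖ ^ 2) P := by
  obtain ⟨L, pr, hlip, hpr⟩ := h.exists_lipschitz_prox_objective hρ'
  simp only [h.sq_norm_gradient_moreauEnvelope hρ' hpr]
  exact (h.memLp_sub_lipschitz_iterate hk hlip).norm.integrable_sq.const_mul _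

theorem integrable_sq_norm_gradient_random_iterate
    (h : IsInertialRun P μ F r ρ M C a b g ξ d τ p K x₀ x) (hK : 1 ≤ K) (hρ' : ρ < ρ')
    (hT : IsRandomIndex P (fun _ => a) K ξ d T) :
    Integrable (fun ω => ‖gradient (moreauEnvelope (1 / ρ') (objective F r)) (x (T ω) ω)‖ ^ 2) P :=
  integrable_comp_random_index hT.measurable (hT.sum_law_const h.step_pos.ne' hK)
    (Φ := fun k ω => ‖gradient (moreauEnvelope (1 / ρ') (objective F r)) (x k ω)‖ ^ 2)
    fun _ hk => h.integrable_sq_norm_gradient_iterate hρ'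
      (Nat.le_succ_of_le (Finset.mem_Icc.1 hk).2)

theorem integral_sq_norm_gradient_random_iterate
    (h : IsInertialRun P μ F r ρ M C a b g ξ d τ p K x₀ x) (hK : 1 ≤ K) (hρ' : ρ < ρ')
    {L : NNReal} {pr : Vec n → Vec n} (hlip : LipschitzWith L pr)
    (hpr : ∀ z, IsProx (1 / ρ') (objective F r) z (pr z))
    (hT : IsRandomIndex P (fun _ => a) K ξ d T) :
    ∫ ω, ‖gradient (moreauEnvelope (1 / ρ') (objective F r)) (x (T ω) ω)‖ ^ 2 ∂P =
      1 / K * (ρ' ^ 2 * ∑ k ∈ Finset.Icc 1 K, ∫ ω, ‖x k ω - pr (x k ω)‖ ^ 2 ∂P) := by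
  have hkK : ∀ k ∈ Finset.Icc 1 K, k ≤ K + 1 := fun k hk =>
    Nat.le_succ_of_le (Finset.mem_Icc.1 hk).2
  have hresidual : Measurable fun y => ρ' ^ 2 * ‖y - pr y‖ ^ 2 :=
    (continuous_const.mul ((continuous_id.sub hlip.continuous).norm.pow 2)).measurable
  simp only [h.sq_norm_gradient_moreauEnvelope hρ' hpr]
  rw [integral_comp_random_index hT.measurable (hT.sum_law_const h.step_pos.ne' hK)
    (Φ := fun k ω => ρ' ^ 2 * ‖x k ω - pr (x k ω)‖ ^ 2)
    (fun k hk => (h.memLp_sub_lipschitz_iterate (hkK k hk) hlip).norm.integrable_sq.const_mul _)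
    fun k hk => hT.indepFun_of_measurable_pastSigma
      (hresidual.comp (h.measurable_iterate_past (hkK k hk) le_rfl))]
  simp only [integral_const_mul, Finset.mul_sum]
  exact Finset.sum_congr rfl fun k hk => by rw [hT.law_const h.step_pos.ne' hk]

end Gradient

theorem integral_sq_norm_gradient_random_iterate_le [IsProbabilityMeasure P]
    [IsProbabilityMeasure μ] {ρ' α β : ℝ}
    (h : IsInertialRun P μ F r ρ M C (α / √(K : ℝ)) (β / (K : ℝ) ^ (1 / 4 : ℝ)) g ξ d τ p K x₀ x)
    (hK : 1 ≤ K) (hρ' : ρ < ρ') (hα : α / √(K : ℝ) ≤ 1 / ρ')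
    (hβ : β / (K : ℝ) ^ (1 / 4 : ℝ) < 1 - α * ρ / (2 * √(K : ℝ)))
    (hT : IsRandomIndex P (fun _ => α / √(K : ℝ)) K ξ d T) :
    ∫ ω, ‖gradient (moreauEnvelope (1 / ρ') (objective F r)) (x (T ω) ω)‖ ^ 2 ∂P ≤
      rateBound ρ ρ' α β M C τ (F x₀) (objective F r x₀).toReal
        (moreauEnvelope (1 / ρ') (objective F r) x₀) (optValue (objective F r)).toReal K := by
  obtain ⟨L, pr, hlip, hpr⟩ := h.exists_lipschitz_prox_objective hρ'
  have hρ'₀ : 0 < ρ' := h.weaklyConvex.1.trans hρ'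
  have : 0 < ρ' - ρ := sub_pos.2 hρ'
  have ha := h.step_pos
  have hincrements := h.sum_integral_sq_increment_le (gam_pos hβ) (two_mul_gam ρ α β K)
  rw [← moveBound_eq hK] at hincrements
  have hresidual := h.sum_integral_sq_residual_le hK hρ' ((le_div_iff₀ hρ'₀).1 hα) hincrements
    hlip hpr
  rw [h.integral_sq_norm_gradient_random_iterate hK hρ' hlip hpr hT,
    rateBound_eq hK _ _ _ _ _ _ _ _ _ _ _ rfl rfl rfl]
  generalize α / √(K : ℝ) = a at *
  set S := ∑ k ∈ Finset.Icc 1 K, ∫ ω, ‖x k ω - pr (x k ω)‖ ^ 2 ∂P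
  have hscale : 1 / (K : ℝ) * (ρ' ^ 2 * S) =
      2 * ρ' / ((ρ' - ρ) * a * K) * (ρ' / 2 * (a * (ρ' - ρ)) * S) := by
    field_simp
  have hloss : C - F x₀ ≤ max 0 (-F x₀) + C := by linarith [le_max_right 0 (-F x₀)]
  rw [hscale]
  gcongr
  refine hresidual.trans ?_
  gcongr

theorem of_isSubgradientOracle {f : Vec n → Ξ → ℝ} {a b : ℝ}
    (hweak : WeaklyConvex ρ (expectedLoss f μ)) (hr : ClosedConvex r)
    (hbdd : optValue (objective (expectedLoss f μ) r) ≠ ⊥)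
    (hC : ∀ y ∈ effDom r, expectedLoss f μ y ≤ C) (ha : 0 < a) (hb : 0 ≤ b) (hM : 0 ≤ M)
    (hg : ∀ k ∈ Set.Icc 1 K, IsSubgradientOracle f r μ (g k))
    (hunb : ∀ k ∈ Set.Icc 1 K, Unbiased f r μ (g k)) (hbound : BoundedSubgradients f r μ M)
    (hsamp : IsSampling P μ τ p K ξ d)
    (hx : IsIterateSequence r g (fun _ => a) (fun _ => b) ξ d K x₀ x) :
    IsInertialRun P μ (expectedLoss f μ) r ρ M C a b g ξ d τ p K x₀ x where
  weaklyConvex := hweak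
  closedConvex := hr
  optValue_ne_bot := hbdd
  loss_le := hC
  step_pos := ha
  inertia_nonneg := hb
  bound_nonneg := hM
  oracle_measurable k hk := (hg k hk).measurable
  oracle_lintegral_sq_le k hk y hy := hbound y hy (g k y)
    ((hg k hk).measurable.comp measurable_prodMk_left) ((hg k hk).mem_subdiff y hy)
  oracle_mean_mem := hunb
  sampling := hsamp
  iterates := hx

end IsInertialRun

end InertialSubgradient

end

theorem mainTheorem1_general {n : ℕ} {Ξ Ω : Type*} [MeasurableSpace Ξ] [MeasurableSpace Ω]
    {P : Measure Ω} [IsProbabilityMeasure P] {μ : Measure Ξ} [IsProbabilityMeasure μ]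
    {F : Vec n → ℝ} {r : Vec n → EReal} {ρ ρ' M C_F α β : ℝ} {K : ℕ}
    {g : ℕ → Vec n → Ξ → Vec n} {ξ : ℕ → Ω → Ξ} {d : ℕ → Ω → ℕ} {τ : ℕ} {p : ℕ → ℝ}
    {x₀ : Vec n} {x : ℕ → Ω → Vec n} {T : Ω → ℕ} (hK : 1 ≤ K) (hρ' : ρ < ρ')
    (hαK : α / √(K : ℝ) ≤ 1 / ρ')
    (hβK : β / (K : ℝ) ^ (1 / 4 : ℝ) < 1 - α * ρ / (2 * √(K : ℝ)))
    (hrun : IsInertialRun P μ F r ρ M C_F (α / √(K : ℝ)) (β / (K : ℝ) ^ (1 / 4 : ℝ))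
      g ξ d τ p K x₀ x)
    (hT : IsRandomIndex P (fun _ => α / √(K : ℝ)) K ξ d T) :
    Differentiable ℝ (moreauEnvelope (1 / ρ') (objective F r)) ∧
    Integrable (fun ω => ‖gradient (moreauEnvelope (1 / ρ') (objective F r)) (x (T ω) ω)‖ ^ 2) P ∧
    ∫ ω, ‖gradient (moreauEnvelope (1 / ρ') (objective F r)) (x (T ω) ω)‖ ^ 2 ∂P ≤
      rateBound ρ ρ' α β M C_F τ (F x₀) (objective F r x₀).toReal
        (moreauEnvelope (1 / ρ') (objective F r) x₀) (optValue (objective F r)).toReal K ∧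
    (fun N : ℕ => rateBound ρ ρ' α β M C_F τ (F x₀) (objective F r x₀).toReal
        (moreauEnvelope (1 / ρ') (objective F r) x₀) (optValue (objective F r)).toReal N)
      =O[atTop] (fun N : ℕ => 1 / √(N : ℝ)) := by
  have hα : 0 < α := (div_pos_iff_of_pos_right (by positivity)).1 hrun.step_pos
  exact ⟨hrun.differentiable_moreauEnvelope hρ',
    hrun.integrable_sq_norm_gradient_random_iterate hK hρ' hT,
    hrun.integral_sq_norm_gradient_random_iterate_le hK hρ' hαK hβK hT,
    isBigO_rateBound β M C_F τ _ _ _ _ hα hρ'⟩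

theorem mainTheorem1 {n : ℕ} {Ξ Ω : Type*} [MeasurableSpace Ξ] [MeasurableSpace Ω]
    (P : Measure Ω) [IsProbabilityMeasure P] (μ : Measure Ξ) [IsProbabilityMeasure μ]
    -- the problem: `F = E f(·; ξ)` is weakly convex, `r` is closed convex, `φ = F + r`
    (f : Vec n → Ξ → ℝ) (r : Vec n → EReal) (F : Vec n → ℝ) (φ : Vec n → EReal)
    (hf : ∀ x, Integrable (f x) μ) (hF : F = expectedLoss f μ) (hφ : φ = objective F r)
    (hr : ClosedConvex r) (hφbdd : optValue φ ≠ ⊥)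
    (ρ : ℝ) (hweak : WeaklyConvex ρ F)
    (C_F : ℝ) (hCF : ∀ x ∈ effDom r, F x ≤ C_F)
    -- parameters
    (K : ℕ) (hK : 1 ≤ K) (ρ' : ℝ) (hρ' : ρ' ∈ Set.Ioc ρ (2 * ρ))
    (α β : ℝ) (hα : 0 < α) (hβ : 0 ≤ β)
    (hαK : α / √(K : ℝ) ≤ 1 / ρ')
    (hβK : β / (K : ℝ) ^ (1 / 4 : ℝ) < 1 - α * ρ / (2 * √(K : ℝ)))
    (a b : ℕ → ℝ) (ha : ∀ k ∈ Set.Icc 1 K, a k = α / √(K : ℝ))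
    (hb : ∀ k ∈ Set.Icc 1 K, b k = β / (K : ℝ) ^ (1 / 4 : ℝ))
    -- unbiased sample subgradients with bounded second moment
    (g : ℕ → Vec n → Ξ → Vec n) (M : ℝ) (hM : 0 ≤ M)
    (hg : ∀ k ∈ Set.Icc 1 K, IsSubgradientOracle f r μ (g k))
    (hunb : ∀ k ∈ Set.Icc 1 K, Unbiased f r μ (g k))
    (hbound : BoundedSubgradients f r μ M)
    -- samples, delays, the iterates, and the random output index
    (ξ : ℕ → Ω → Ξ) (d : ℕ → Ω → ℕ) (τ : ℕ) (p : ℕ → ℝ)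
    (hsamp : IsSampling P μ τ p K ξ d)
    (x₀ : Vec n) (x : ℕ → Ω → Vec n)
    (hx : IsIterateSequence r g a b ξ d K x₀ x)
    (T : Ω → ℕ) (hT : IsRandomIndex P a K ξ d T) :
    Differentiable ℝ (moreauEnvelope (1 / ρ') φ) ∧
    Integrable (fun ω => ‖gradient (moreauEnvelope (1 / ρ') φ) (x (T ω) ω)‖ ^ 2) P ∧
    ∫ ω, ‖gradient (moreauEnvelope (1 / ρ') φ) (x (T ω) ω)‖ ^ 2 ∂P ≤
      rateBound ρ ρ' α β M C_F τ (F x₀) (φ x₀).toReal (moreauEnvelope (1 / ρ') φ x₀)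
        (optValue φ).toReal K ∧
    (fun N : ℕ => rateBound ρ ρ' α β M C_F τ (F x₀) (φ x₀).toReal
        (moreauEnvelope (1 / ρ') φ x₀) (optValue φ).toReal N)
      =O[atTop] (fun N : ℕ => 1 / √(N : ℝ)) := by
  subst hφ hF
  have ha₀ : 0 < α / √(K : ℝ) := by positivity
  have hb₀ : 0 ≤ β / (K : ℝ) ^ (1 / 4 : ℝ) := by positivity
  exact mainTheorem1_general hK hρ'.1 hαK hβK (.of_isSubgradientOracle hweak hr hφbdd hCF ha₀ hb₀
    hM hg hunb hbound hsamp (hx.congr ha hb)) (hT.congr ha)
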